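/- Let $\{e_t\}_{t\in\mathbb Z}$ be independent (not necessarily identically distributed) real random variables with mean zero and common variance $\sigma^2$, let $a_1,a_2,\dots$ be real numbers with $\sum_{i\ge1}|a_i|<\infty$ and $A(z)=1+\sum_{i\ge 1}a_iz^i\neq0$ for all complex $|z|\le1$, and let $\{x_t\}_{t\in\mathbb Z}$ be a (second-order) stationary process with $x_t+\sum_{i\ge1}a_ix_{t-i}=e_t$ almost surely for every $t\in\mathbb Z$. For $k\ge1$ put $\mathbf x_j(k)=(x_j,\dots,x_{j-k+1})'$, let $\mathbf a(k)=(a_1(k),\dots,a_k(k))'$ be the minimizer (unique if $\sigma^2>0$) of $m_k(\mathbf c)=E(x_{k+1}+\mathbf x_k(k)'\mathbf c)^2$ over $\mathbf c\in\mathbb R^k$, also viewed as an infinite vector with $a_i(k)=0$ for $i>k$, and put $e_{t+1,k}=x_{t+1}+\mathbf x_t(k)'\mathbf a(k)$. For $\mathbf d=(d_1,d_2,\dots)'$ let $\|\mathbf d\|_R^2=\sum_{i,j\ge1}d_id_j\gamma_{i-j}$ with $\gamma_{i-j}=E(x_ix_j)$. For integers $0\le K_n\le n-1$ let $N=n-K_n$,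 $S_k^2=N^{-1}\sum_{t=K_n}^{n-1}e_{t+1,k}^2$ and $\sigma_k^2=E(S_k^2)$. Lemma 6. Suppose that $\sup_{t\in\mathbb Z}E|e_t|^{2q}<\infty$ for some real $q\ge2$. Then there is a constant $C>0$, depending only on the process and on $q$ (not on $n$, $K_n$, $k$, $j$), such that for all $n$ and all $K_n\le n-1$, $$\max_{1\le k\le K_n}E|S_k^2-\sigma_k^2|^q\le C\,N^{-q/2},$$ and, for all $1\le k,j\le K_n$, $$E\bigl|S_k^2-\sigma_k^2-(S_j^2-\sigma_j^2)\bigr|^q\le C\,N^{-q/2}\,\|\mathbf a(j)-\mathbf a(k)\|_R^q .$$ -/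

import Mathlib

open MeasureTheory ProbabilityTheory
open scoped ENNReal

namespace ARInf

noncomputable section

/-! Infinite-dimensional vectors `(d₁, d₂, …)'` are functions `d : ℕ → ℝ`, counted from `0`:
`d i` is the entry `d_{i+1}`.  The same convention is used for vectors in `ℝᵏ`. -/

variable {Ω : Type*} [MeasurableSpace Ω]

/-- `A(z) = 1 + a₁ z + a₂ z² + ⋯` -/
def charSeries (a : ℕ → ℝ) (z : ℂ) : ℂ := 1 + ∑' i : ℕ, (a i : ℂ) * z ^ (i + 1)

/-- Second-order (wide-sense) stationarity of a real process indexed by `ℤ`. -/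
structure IsStationary (μ : Measure Ω) (x : ℤ → Ω → ℝ) : Prop where
  measurable : ∀ t, Measurable (x t)
  memLp : ∀ t, MemLp (x t) 2 μ
  mean_eq : ∀ s t, ∫ ω, x s ω ∂μ = ∫ ω, x t ω ∂μ
  cov_shift : ∀ s t h, ∫ ω, x (s + h) ω * x (t + h) ω ∂μ = ∫ ω, x s ω * x t ω ∂μ

/-- Independent noise (not necessarily identically distributed) with mean `0` and variance `σ²`. -/
structure IsNoise (μ : Measure Ω) (e : ℤ → Ω → ℝ) (σ : ℝ) : Prop where
  measurable : ∀ t, Measurable (e t)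
  indep : iIndepFun e μ
  memLp : ∀ t, MemLp (e t) 2 μ
  mean_zero : ∀ t, ∫ ω, e t ω ∂μ = 0
  variance_eq : ∀ t, Var[e t; μ] = σ ^ 2

/-- `x` is a stationary AR(∞) process with noise `e`, absolutely summable coefficients
`a₁, a₂, …`, and `A(z) ≠ 0` for `|z| ≤ 1`:  `x_t + ∑_{i ≥ 1} a_i x_{t-i} = e_t` for all `t`. -/
structure IsAR (μ : Measure Ω) (x e : ℤ → Ω → ℝ) (a : ℕ → ℝ) (σ : ℝ) : Prop where
  stationary : IsStationary μ x
  noise : IsNoise μ e σ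
  summable : Summable fun i => |a i|
  charSeries_ne_zero : ∀ z : ℂ, ‖z‖ ≤ 1 → charSeries a z ≠ 0
  eqn : ∀ t : ℤ, ∀ᵐ ω ∂μ,
    HasSum (fun i : ℕ => a i * x (t - ((i : ℤ) + 1)) ω) (e t ω - x t ω)

/-- `x_{j+1} + 𝐱_j(k)' c`, where `𝐱_j(k) = (x_j, …, x_{j-k+1})'`. -/
def resid (x : ℤ → Ω → ℝ) {k : ℕ} (c : Fin k → ℝ) (j : ℤ) (ω : Ω) : ℝ :=
  x (j + 1) ω + ∑ i : Fin k, x (j - (i : ℕ)) ω * c i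

/-- `m_k(c) = E (x_{k+1} + 𝐱_k(k)' c)²`, `c ∈ ℝᵏ`. -/
def mse (μ : Measure Ω) (x : ℤ → Ω → ℝ) (k : ℕ) (c : Fin k → ℝ) : ℝ :=
  ∫ ω, (resid x c (k : ℤ) ω) ^ 2 ∂μ

/-- `𝐚(k) = (a₁(k), …, a_k(k))'`, the minimizer of `m_k` over `ℝᵏ`. -/
def coef (μ : Measure Ω) (x : ℤ → Ω → ℝ) (k : ℕ) : Fin k → ℝ :=
  Classical.epsilon fun c => ∀ c' : Fin k → ℝ, mse μ x k c ≤ mse μ x k c'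

/-- `𝐚(k)` viewed as an infinite-dimensional vector (`a_i(k) = 0` for `i > k`). -/
def coefSeq (μ : Measure Ω) (x : ℤ → Ω → ℝ) (k : ℕ) (i : ℕ) : ℝ :=
  if h : i < k then coef μ x k ⟨i, h⟩ else 0

/-- The autocovariance `γ_h`, with `γ_{i-j} = E (x_i x_j)`. -/
def autocov (μ : Measure Ω) (x : ℤ → Ω → ℝ) (h : ℤ) : ℝ := ∫ ω, x h ω * x 0 ω ∂μ

/-- `‖d‖_R`, where `‖d‖_R² = ∑_{1 ≤ i, j < ∞} d_i d_j γ_{i-j}`. -/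
def normR (μ : Measure Ω) (x : ℤ → Ω → ℝ) (d : ℕ → ℝ) : ℝ :=
  √(∑' p : ℕ × ℕ, d p.1 * d p.2 * autocov μ x ((p.1 : ℤ) - (p.2 : ℤ)))

/-- `S_k² = N⁻¹ ∑_{t=K}^{n-1} e_{t+1,k}²`, where `N = n - K` and
`e_{t+1,k} = x_{t+1} + 𝐱_t(k)' 𝐚(k)`. -/
def sampleVar (μ : Measure Ω) (x : ℤ → Ω → ℝ) (n K k : ℕ) (ω : Ω) : ℝ :=
  1 / ((n : ℝ) - (K : ℝ)) * ∑ t ∈ Finset.Ico K n, (resid x (coef μ x k) (t : ℤ) ω) ^ 2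

/-- `S_k² - σ_k²`, where `σ_k² = E S_k²`. -/
def centeredVar (μ : Measure Ω) (x : ℤ → Ω → ℝ) (n K k : ℕ) (ω : Ω) : ℝ :=
  sampleVar μ x n K k ω - ∫ ω', sampleVar μ x n K k ω' ∂μ

end

end ARInf

/-! By Wiener's lemma `1/A(z)` has absolutely summable coefficients `b`, so `x` is a causal moving
average of the noise, and the prediction error of order `k` is the moving average with coefficients
`β_k = (1, a₁(k), …, a_k(k)) * b`. Each centred sample variance is then a centred quadratic form in
independent variables, and two facts carry the proof.

The first is a moment inequality of Whittle type (`momentBound_quadratic_form`): the squared `L^q`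
norm of a centred quadratic form with matrix `M` is at most a constant times the squared Frobenius
norm of `M`. Splitting the form into its diagonal and a martingale reduces this to a Burkholder-type
inequality, obtained from an elementary expansion of `|a + b|^q`. For the sum over `N` times of
products of two moving averages with coefficients `β` and `c`, the Frobenius norm squared is at most
`N ‖c‖₁² ‖β‖₂²` (`sum_sq_window_le`). One factor is thus measured only in `ℓ²`, and division by `N`
leaves the rate `N⁻¹` for the squared norm.

The second is a bound on `‖β_k‖₁` uniform in `k`. It follows from Baxter's argument for finite
Toeplitz systems (`IsInversePair.sum_abs_le_of_correlation_eq_zero`) applied to the normal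
equations.

The first estimate takes `β = c = β_k`. For the second, the difference of squares factors as `(e_k -
e_j)(e_k + e_j)`: the sum is controlled in `ℓ¹` by the uniform bound, while the difference enters
through `σ² ‖β_k - β_j‖₂²`, which equals `‖𝐚(j) - 𝐚(k)‖_R²`. -/

/-! ### Wiener's lemma for absolutely summable power series -/

section Wiener

/-- The right shift of a sequence. -/
def shiftSeq (f : ℕ → ℂ) : ℕ → ℂ
  | 0 => 0
  | n + 1 => f n

theorem memlp_one_iff (f : ℕ → ℂ) : Memℓp f 1 ↔ Summable fun n => ‖f n‖ := by
  rw [memℓp_gen_iff (by simp)]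
  simp

theorem norm_lp_one (f : lp (fun _ : ℕ => ℂ) 1) : ‖f‖ = ∑' n, ‖f n‖ := by
  rw [lp.norm_eq_tsum_rpow (by simp)]
  simp

theorem memlp_shiftSeq {f : ℕ → ℂ} (hf : Memℓp f 1) : Memℓp (shiftSeq f) 1 := by
  rw [memlp_one_iff, ← summable_nat_add_iff 1]
  exact (memlp_one_iff _).1 hf

/-- Nontriviality gives the algebra of bounded operators on `ℓ¹` the property `‖1‖ = 1`. -/
instance : Nontrivial (lp (fun _ : ℕ => ℂ) 1) :=
  ⟨⟨lp.single 1 0 1, 0, fun h => by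
    have := congrArg (fun f : lp (fun _ : ℕ => ℂ) 1 => f 0) h
    simp at this⟩⟩

/-- The right shift on `ℓ¹(ℕ)`. -/
noncomputable def shiftOp : lp (fun _ : ℕ => ℂ) 1 →L[ℂ] lp (fun _ : ℕ => ℂ) 1 :=
  LinearMap.mkContinuous
    { toFun := fun f => ⟨shiftSeq f, memlp_shiftSeq f.2⟩
      map_add' := fun f g => by
        ext n
        cases n
        · exact (add_zero (0 : ℂ)).symm
        · rfl
      map_smul' := fun c f => by
        ext n
        cases n
        · exact (mul_zero c).symm
        · rfl } 1 (fun f => by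
          rw [norm_lp_one, norm_lp_one, one_mul, Summable.tsum_eq_zero_add]
          · simp [shiftSeq]
          · rw [← summable_nat_add_iff 1]
            exact (memlp_one_iff _).1 f.2)

theorem shiftOp_norm_le : ‖shiftOp‖ ≤ 1 := LinearMap.mkContinuous_norm_le _ zero_le_one _

theorem shiftOp_pow_apply (f : lp (fun _ : ℕ => ℂ) 1) (i n : ℕ) :
    ((shiftOp ^ i) f : ℕ → ℂ) n = if i ≤ n then f (n - i) else 0 := by
  induction i generalizing n with
  | zero => simp
  | succ i ih =>
    rw [pow_succ']
    change shiftSeq ((shiftOp ^ i) f : ℕ → ℂ) n = _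
    cases n with
    | zero => simp [shiftSeq]
    | succ n => 
      simp only [shiftSeq, ih, Nat.add_le_add_iff_right, Nat.add_sub_add_right]

/-- Gelfand theory in the closed subalgebra generated by `s`, which is commutative even when `A` is
not. A non-invertible element is killed by some character `f`; since `‖f s‖ ≤ ‖s‖ ≤ 1`, the power
series would vanish at the point `f s` of the closed disc. -/
theorem isUnit_powerSeries_elemental {A : Type*} [NormedRing A] [NormedAlgebra ℂ A]
    [CompleteSpace A] [NormOneClass A] (s : A) (hs : ‖s‖ ≤ 1) (c : ℕ → ℂ)
    (hc : Summable fun n => ‖c n‖)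
    (h0 : ∀ z : ℂ, ‖z‖ ≤ 1 → ∑' n, c n * z ^ n ≠ 0) :
    ∃ y : A, (∑' n, c n • s ^ n) * y = 1 := by
  let E := Algebra.elemental ℂ s
  let _ : NormedCommRing E :=
    { (inferInstance : NormedRing E) with
      mul_comm := mul_comm }
  have : CompleteSpace E := inferInstance
  have : NormOneClass E := ⟨norm_one (α := A)⟩
  let s' : E := ⟨s, Algebra.elemental.self_mem ℂ s⟩
  have hs' : ‖s'‖ ≤ 1 := hs
  have hpow : ∀ n, ‖s' ^ n‖ ≤ 1 := fun n => by
    change ‖s ^ n‖ ≤ 1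
    exact (norm_pow_le _ _).trans (pow_le_one₀ (norm_nonneg _) hs)
  have hsum : Summable fun n => c n • s' ^ n := by
    refine Summable.of_norm_bounded hc fun n => ?_
    rw [norm_smul]
    exact mul_le_of_le_one_right (norm_nonneg _) (hpow n)
  have hu : IsUnit (∑' n, c n • s' ^ n) := by
    by_contra hu
    obtain ⟨f, hf⟩ := WeakDual.CharacterSpace.exists_apply_eq_zero hu
    have hfs : ‖f s'‖ ≤ 1 := by
      have := (spectrum.norm_le_norm_of_mem (AlgHom.apply_mem_spectrum f s'))
      exact this.trans hs'
    refine h0 (f s') hfs ?_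
    rw [← hf]
    have h1 : HasSum (fun n => f (c n • s' ^ n)) (f (∑' n, c n • s' ^ n)) :=
      hsum.hasSum.map f (map_continuous f)
    rw [← h1.tsum_eq]
    congr 1
    ext n
    rw [map_smul, map_pow, smul_eq_mul]
  obtain ⟨y, hy⟩ := hu.exists_right_inv
  refine ⟨(y : A), ?_⟩
  have h2 : HasSum (fun n => ((c n • s' ^ n : E) : A)) ((∑' n, c n • s' ^ n : E) : A) :=
    hsum.hasSum.map E.subtype continuous_subtype_val
  have h3 : ∑' n, c n • s ^ n = ((∑' n, c n • s' ^ n : E) : A) := by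
    rw [← h2.tsum_eq]
    rfl
  rw [h3]
  exact congrArg Subtype.val hy

/-- Wiener's lemma for power series. -/
theorem exists_summable_inverse (c : ℕ → ℝ) (hc : Summable fun n => |c n|)
    (h0 : ∀ z : ℂ, ‖z‖ ≤ 1 → ∑' n, (c n : ℂ) * z ^ n ≠ 0) :
    ∃ b : ℕ → ℝ, (Summable fun n => |b n|) ∧
      ∀ n, ∑ i ∈ Finset.range (n + 1), c i * b (n - i) = if n = 0 then 1 else 0 := by
  have hc' : Summable fun n => ‖(c n : ℂ)‖ := by simpa using hc
  obtain ⟨y, hy⟩ := isUnit_powerSeries_elemental shiftOp shiftOp_norm_le (fun n => (c n : ℂ)) hc' h0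
  -- Power series in the shift act on `ℓ¹` by convolution, so the inverse operator applied to the
  -- unit mass at `0` is the inverse sequence. Its real part suffices because `c` is real.
  let d : lp (fun _ : ℕ => ℂ) 1 := lp.single 1 0 1
  let b := y d
  have hb : Summable fun n => ‖b n‖ := (memlp_one_iff _).1 b.2
  have hsum : Summable fun n => (c n : ℂ) • shiftOp ^ n := by
    refine Summable.of_norm_bounded hc' fun n => ?_
    rw [norm_smul]
    exact mul_le_of_le_one_right (norm_nonneg _)
      ((norm_pow_le _ _).trans (pow_le_one₀ (norm_nonneg _) shiftOp_norm_le))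
  refine ⟨fun n => (b n).re, Summable.of_nonneg_of_le (fun _ => abs_nonneg _)
    (fun n => Complex.abs_re_le_norm _) hb, fun n => ?_⟩
  have h1 : (∑' n, (c n : ℂ) • shiftOp ^ n) b = d := by
    change ((∑' n, (c n : ℂ) • shiftOp ^ n) * y) d = d
    rw [hy]; rfl
  have h2 : HasSum (fun i => ((c i : ℂ) • shiftOp ^ i) b) d := by
    rw [← h1]
    exact hsum.hasSum.map (ContinuousLinearMap.apply ℂ _ b) (ContinuousLinearMap.continuous _)
  have h3 : HasSum (fun i => (c i : ℂ) * (if i ≤ n then b (n - i) else 0)) (d n) := by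
    have := h2.map (lp.evalCLM ℂ (fun _ : ℕ => ℂ) 1 n) (ContinuousLinearMap.continuous _)
    convert this using 2 with i
    · simp only [Function.comp, lp.evalCLM]
      change _ = (c i : ℂ) * ((shiftOp ^ i) b : ℕ → ℂ) n
      rw [shiftOp_pow_apply]
    · rfl
  have h4 : ∑ i ∈ Finset.range (n + 1), (c i : ℂ) * b (n - i) = d n := by
    rw [← h3.tsum_eq, tsum_eq_sum (s := Finset.range (n + 1))]
    · refine Finset.sum_congr rfl fun i hi => ?_
      rw [if_pos (by simpa [Nat.lt_succ_iff] using hi)]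
    · intro i hi
      rw [if_neg (by simpa [Nat.lt_succ_iff] using hi), mul_zero]
  have h5 := congrArg Complex.re h4
  rw [Complex.re_sum] at h5
  simp only [Complex.re_ofReal_mul] at h5
  rw [h5]
  by_cases hn : n = 0
  · subst hn; simp [d]
  · simp [d, hn]

end Wiener

/-! ### Pointwise inequalities for q-th powers -/

section Moments

/-- Second-order expansion with an exact linear term, so that this term disappears on integrating
against a martingale difference. For `|s| ≥ 1/(2q)` the remainder dominates everything. -/
theorem abs_one_add_rpow_le {q : ℝ} (hq : 2 ≤ q) (s : ℝ) :
    |1 + s| ^ q ≤ 1 + q * s + ((1 + 2 * q) ^ q + 2 * q ^ 2) * (s ^ 2 + |s| ^ q) := by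
  have hpos : (0 : ℝ) ≤ (1 + 2 * q) ^ q := by positivity
  have hsq : (0 : ℝ) ≤ |s| ^ q := by positivity
  rcases le_total |s| (1 / (2 * q)) with h | h
  · have h1 : |s| * q ≤ 1 / 2 := by
      calc |s| * q ≤ 1 / (2 * q) * q := by gcongr
        _ = 1 / 2 := by field_simp
    have h2 : |s| ≤ 1 / 4 := by nlinarith [abs_nonneg s]
    obtain ⟨hl, hr⟩ := abs_le.1 h2
    have hqs : |q * s| ≤ 1 / 2 := by
      rw [abs_mul, abs_of_pos (by linarith : 0 < q), mul_comm]; exact h1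
    obtain ⟨hl', hr'⟩ := abs_le.1 hqs
    have hs1 : 0 < 1 + s := by linarith
    -- Bernoulli bounds powers from below; applied to `(1 + s)⁻¹ = 1 - s/(1 + s)` and inverted, it
    -- yields the upper bound on `(1 + s)^q` without Taylor's formula.
    have hB := one_add_mul_self_le_rpow_one_add (s := -s / (1 + s)) (p := q)
      (by rw [le_div_iff₀ hs1]; linarith) (by linarith)
    have e1 : 1 + -s / (1 + s) = (1 + s)⁻¹ := by field_simp; ring
    rw [e1, Real.inv_rpow hs1.le] at hB
    have e2 : 1 + q * (-s / (1 + s)) = (1 + s - q * s) / (1 + s) := by field_simp; ring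
    rw [e2] at hB
    have hd : 1 / 4 ≤ 1 + s - q * s := by linarith
    have hd2 : 1 / 2 ≤ 1 + s - q * s := by
      rcases le_total 0 s with h0 | h0 <;> nlinarith
    have h3 : (1 + s) ^ q ≤ (1 + s) / (1 + s - q * s) := by
      have h4 : 0 < (1 + s) ^ q := Real.rpow_pos_of_pos hs1 q
      rw [le_div_iff₀ (by linarith)]
      rw [div_le_iff₀ hs1, inv_mul_eq_div, le_div_iff₀ h4] at hB
      linarith
    rw [abs_of_pos hs1]
    have h5 : (1 + s) / (1 + s - q * s) ≤ 1 + q * s + 2 * q ^ 2 * s ^ 2 := by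
      rw [div_le_iff₀ (by linarith)]
      have : (1 + q * s + 2 * q ^ 2 * s ^ 2) * (1 + s - q * s) - (1 + s)
          = s ^ 2 * (2 * q ^ 2 * (1 + s - q * s) - q * (q - 1)) := by ring
      have h6 : 0 ≤ s ^ 2 * (2 * q ^ 2 * (1 + s - q * s) - q * (q - 1)) := by
        apply mul_nonneg (sq_nonneg s)
        nlinarith [sq_nonneg q]
      linarith
    have : 0 ≤ (1 + 2 * q) ^ q * (s ^ 2 + |s| ^ q) + 2 * q ^ 2 * |s| ^ q := by positivity
    nlinarith
  · have h1 : 1 ≤ |s| * (2 * q) := by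
      rwa [div_le_iff₀ (by positivity)] at h
    have h2 : |1 + s| ≤ (1 + 2 * q) * |s| := by
      have := abs_add_le 1 s
      rw [abs_one] at this
      linarith
    have h3 : |1 + s| ^ q ≤ (1 + 2 * q) ^ q * |s| ^ q := by
      rw [← Real.mul_rpow (by positivity) (abs_nonneg s)]
      exact Real.rpow_le_rpow (abs_nonneg _) h2 (by linarith)
    have h4 : -(q * s) ≤ 2 * q ^ 2 * s ^ 2 := by
      have : -(q * s) ≤ q * |s| := by nlinarith [neg_abs_le s]
      have h5 : q * |s| * 1 ≤ q * |s| * (|s| * (2 * q)) := by gcongr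
      rw [← sq_abs s]
      nlinarith
    have : 0 ≤ (1 + 2 * q) ^ q * s ^ 2 + 2 * q ^ 2 * |s| ^ q := by positivity
    nlinarith

theorem abs_rpow_split (q : ℝ) {a : ℝ} (ha : a ≠ 0) :
    |a| ^ q = |a| ^ (q - 2) * a ^ 2 := by
  rw [← sq_abs, ← Real.rpow_two, ← Real.rpow_add (abs_pos.2 ha)]
  congr 1; ring

theorem abs_add_rpow_le {q : ℝ} (hq : 2 ≤ q) (a b : ℝ) :
    |a + b| ^ q ≤ |a| ^ q + q * (|a| ^ (q - 2) * a * b) +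
      ((1 + 2 * q) ^ q + 2 * q ^ 2) * (|a| ^ (q - 2) * b ^ 2 + |b| ^ q) := by
  have hpos : (1 : ℝ) ≤ (1 + 2 * q) ^ q := Real.one_le_rpow (by linarith) (by linarith)
  by_cases ha : a = 0
  · subst ha
    have h1 : (0 : ℝ) ≤ |(0 : ℝ)| ^ (q - 2) * b ^ 2 := by positivity
    have h2 : (0 : ℝ) ≤ |b| ^ q := by positivity
    have h3 : (0 : ℝ) ≤ |(0 : ℝ)| ^ q := by positivity
    rw [zero_add, mul_zero, zero_mul, mul_zero, add_zero]
    nlinarith [sq_nonneg q]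
  · have h := abs_one_add_rpow_le hq (b / a)
    have h0 : 0 < |a| ^ q := Real.rpow_pos_of_pos (abs_pos.2 ha) q
    have h1 := mul_le_mul_of_nonneg_left h h0.le
    rw [← Real.mul_rpow (abs_nonneg _) (abs_nonneg _), ← abs_mul] at h1
    have e1 : a * (1 + b / a) = a + b := by field_simp
    rw [e1] at h1
    have e2 : |a| ^ q * |b / a| ^ q = |b| ^ q := by
      rw [← Real.mul_rpow (abs_nonneg _) (abs_nonneg _), ← abs_mul]
      congr 2; field_simp
    refine h1.trans (le_of_eq ?_)
    have e3 : |a| ^ q * (b / a) = |a| ^ (q - 2) * a * b := by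
      rw [abs_rpow_split q ha]; field_simp
    have e4 : |a| ^ q * (b / a) ^ 2 = |a| ^ (q - 2) * b ^ 2 := by
      rw [abs_rpow_split q ha]; field_simp
    rw [← e4, ← e3, ← e2]
    ring

theorem rpow_sub_two_mul_sq_le {q : ℝ} (hq : 2 ≤ q) {s t : ℝ} (hs : 0 ≤ s) (ht : 0 ≤ t) :
    s ^ (q - 2) * t ^ 2 ≤ s ^ q + t ^ q := by
  have key : ∀ m : ℝ, 0 ≤ m → m ^ (q - 2) * m ^ 2 = m ^ q := fun m hm => by
    rw [← Real.rpow_two, ← Real.rpow_add_of_nonneg hm (by linarith) (by norm_num)]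
    congr 1
    ring
  have h1 : 0 ≤ s ^ q := by positivity
  have h2 : 0 ≤ t ^ q := by positivity
  rcases le_total s t with h | h
  · have : s ^ (q - 2) * t ^ 2 ≤ t ^ (q - 2) * t ^ 2 := by gcongr
    rw [key t ht] at this
    linarith
  · have : s ^ (q - 2) * t ^ 2 ≤ s ^ (q - 2) * s ^ 2 := by gcongr
    rw [key s hs] at this
    linarith

/-- `(V + h)^p` dominates `V^p + V^{p-1}h` and `V^p + h^p`. -/
theorem add_rpow_lower {p V h C : ℝ} (hp : 1 ≤ p) (hV : 0 < V) (hh : 0 < h) (hC : 1 ≤ C) :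
    V ^ p + C / 2 * (V ^ (p - 1) * h + h ^ p) ≤ (V + C * h) ^ p := by
  have hCh : 0 < C * h := by positivity
  have h1 : V ^ p + V ^ (p - 1) * (C * h) ≤ (V + C * h) ^ p := by
    have e : V + C * h = V * (1 + C * h / V) := by field_simp
    rw [e, Real.mul_rpow hV.le (by positivity)]
    have hB := one_add_mul_self_le_rpow_one_add (s := C * h / V) (p := p)
      (by have : 0 ≤ C * h / V := by positivity
          linarith) hp
    have h3 : V ^ p * (1 + p * (C * h / V)) ≤ V ^ p * (1 + C * h / V) ^ p := by gcongr
    refine le_trans ?_ h3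
    have e2 : V ^ p = V ^ (p - 1) * V := by
      rw [← Real.rpow_add_one hV.ne']; congr 1; ring
    have e3 : V ^ p * (1 + p * (C * h / V)) = V ^ p + p * (V ^ (p - 1) * (C * h)) := by
      rw [e2]; field_simp
    rw [e3]
    have : 0 ≤ V ^ (p - 1) * (C * h) := by positivity
    nlinarith
  have h2 : V ^ p + C * h ^ p ≤ (V + C * h) ^ p := by
    have h4 := Real.add_rpow_le_rpow_add hV.le hCh.le hp
    have h5 : C * h ^ p ≤ (C * h) ^ p := by
      rw [Real.mul_rpow (by linarith) hh.le]
      gcongr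
      exact Real.self_le_rpow_of_one_le hC hp
    linarith
  nlinarith

end Moments

/-! ### Burkholder-type inequality for martingale transforms -/

section MomentBound

variable {Ω : Type*} [MeasurableSpace Ω] {μ : Measure Ω} {q : ℝ}

/-- `f` is measurable and `‖f‖_q² ≤ V`. -/
structure MomentBound (μ : Measure Ω) (q : ℝ) (f : Ω → ℝ) (V : ℝ) : Prop where
  measurable : Measurable f
  nonneg : 0 ≤ V
  integrable : Integrable (fun ω => |f ω| ^ q) μ
  le : ∫ ω, |f ω| ^ q ∂μ ≤ V ^ (q / 2)

theorem abs_add_rpow_le_two {q : ℝ} (hq : 0 ≤ q) (a b : ℝ) :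
    |a + b| ^ q ≤ 2 ^ q * (|a| ^ q + |b| ^ q) := by
  have ha : (0 : ℝ) ≤ |a| ^ q := by positivity
  have hb : (0 : ℝ) ≤ |b| ^ q := by positivity
  have h2 : (0 : ℝ) ≤ 2 ^ q := by positivity
  have h := abs_add_le a b
  rcases le_total |a| |b| with h' | h'
  · calc |a + b| ^ q ≤ (2 * |b|) ^ q := by gcongr; linarith
      _ = 2 ^ q * |b| ^ q := Real.mul_rpow (by norm_num) (abs_nonneg _)
      _ ≤ _ := by nlinarith
  · calc |a + b| ^ q ≤ (2 * |a|) ^ q := by gcongr; linarith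
      _ = 2 ^ q * |a| ^ q := Real.mul_rpow (by norm_num) (abs_nonneg _)
      _ ≤ _ := by nlinarith

theorem measurable_abs_rpow {f : Ω → ℝ} (hf : Measurable f) (q : ℝ) :
    Measurable fun ω => |f ω| ^ q := by fun_prop

theorem integrable_abs_add_rpow (hq : 0 ≤ q) {f g : Ω → ℝ} (hf : Measurable f)
    (hg : Measurable g) (hfi : Integrable (fun ω => |f ω| ^ q) μ)
    (hgi : Integrable (fun ω => |g ω| ^ q) μ) :
    Integrable (fun ω => |f ω + g ω| ^ q) μ := by
  refine Integrable.mono' ((hfi.add hgi).const_mul (2 ^ q))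
    (measurable_abs_rpow (hf.add hg) q).aestronglyMeasurable (Filter.Eventually.of_forall fun ω => ?_)
  rw [Real.norm_of_nonneg (by positivity)]
  exact abs_add_rpow_le_two hq _ _

namespace MomentBound

theorem mono {f : Ω → ℝ} {V W : ℝ} (h : MomentBound μ q f V) (hq : 0 ≤ q) (hVW : V ≤ W) :
    MomentBound μ q f W :=
  ⟨h.measurable, h.nonneg.trans hVW, h.integrable,
    h.le.trans (Real.rpow_le_rpow h.nonneg hVW (by linarith))⟩

theorem const_mul {f : Ω → ℝ} {V : ℝ} (h : MomentBound μ q f V) (c : ℝ) :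
    MomentBound μ q (fun ω => c * f ω) (c ^ 2 * V) := by
  have e : (fun ω => |c * f ω| ^ q) = fun ω => |c| ^ q * |f ω| ^ q := by
    ext ω
    rw [abs_mul, Real.mul_rpow (abs_nonneg _) (abs_nonneg _)]
  have e2 : |c| ^ q = (c ^ 2) ^ (q / 2) := by
    rw [← sq_abs, ← Real.rpow_two, ← Real.rpow_mul (abs_nonneg _)]
    congr 1; ring
  refine ⟨h.measurable.const_mul c, mul_nonneg (sq_nonneg c) h.nonneg, ?_, ?_⟩
  · rw [e]; exact h.integrable.const_mul _
  · rw [e, integral_const_mul, Real.mul_rpow (sq_nonneg c) h.nonneg, e2]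
    exact mul_le_mul_of_nonneg_left h.le (by positivity)

theorem const [IsProbabilityMeasure μ] (c : ℝ) : MomentBound μ q (fun _ => c) (c ^ 2) := by
  refine ⟨measurable_const, sq_nonneg c, integrable_const _, ?_⟩
  rw [integral_const, probReal_univ, one_smul, ← sq_abs, ← Real.rpow_two,
    ← Real.rpow_mul (abs_nonneg _)]
  apply le_of_eq
  congr 1
  ring

/-- A triangle inequality needing no independence. The factor `4` is `2^q` written as `4^(q/2)`, and
`q/2 ≥ 1` makes the power superadditive. -/
theorem add {f g : Ω → ℝ} {V W : ℝ} (hf : MomentBound μ q f V) (hg : MomentBound μ q g W)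
    (hq : 2 ≤ q) : MomentBound μ q (fun ω => f ω + g ω) (4 * (V + W)) := by
  have hVW := add_nonneg hf.nonneg hg.nonneg
  refine ⟨hf.measurable.add hg.measurable, by linarith,
    integrable_abs_add_rpow (by linarith) hf.measurable hg.measurable hf.integrable hg.integrable,
    ?_⟩
  calc ∫ ω, |f ω + g ω| ^ q ∂μ ≤ ∫ ω, 2 ^ q * (|f ω| ^ q + |g ω| ^ q) ∂μ := by
        refine integral_mono
          (integrable_abs_add_rpow (by linarith) hf.measurable hg.measurable hf.integrable
            hg.integrable)
          ((hf.integrable.add hg.integrable).const_mul _) fun ω => ?_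
        exact abs_add_rpow_le_two (by linarith) _ _
    _ = 2 ^ q * (∫ ω, |f ω| ^ q ∂μ + ∫ ω, |g ω| ^ q ∂μ) := by
        rw [integral_const_mul, integral_add hf.integrable hg.integrable]
    _ ≤ 2 ^ q * (V ^ (q / 2) + W ^ (q / 2)) := by
        gcongr
        · exact hf.le
        · exact hg.le
    _ ≤ 2 ^ q * (V + W) ^ (q / 2) := by
        gcongr
        exact Real.add_rpow_le_rpow_add hf.nonneg hg.nonneg (by linarith)
    _ = (4 * (V + W)) ^ (q / 2) := by
        rw [Real.mul_rpow (by norm_num) hVW]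
        congr 1
        rw [show (4 : ℝ) = 2 ^ (2 : ℝ) by norm_num, ← Real.rpow_mul (by norm_num)]
        congr 1; ring

/-- A product of independent variables. -/
theorem mul_indep {f g : Ω → ℝ} {V W : ℝ} (hf : MomentBound μ q f V)
    (hg : MomentBound μ q g W) (h : IndepFun f g μ) :
    MomentBound μ q (fun ω => f ω * g ω) (V * W) := by
  have hi : IndepFun (fun ω => |f ω| ^ q) (fun ω => |g ω| ^ q) μ :=
    h.comp (φ := fun x : ℝ => |x| ^ q) (ψ := fun x : ℝ => |x| ^ q) (by fun_prop) (by fun_prop)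
  have e : (fun ω => |f ω * g ω| ^ q) = fun ω => |f ω| ^ q * |g ω| ^ q := by
    ext ω
    rw [abs_mul, Real.mul_rpow (abs_nonneg _) (abs_nonneg _)]
  refine ⟨hf.measurable.mul hg.measurable, mul_nonneg hf.nonneg hg.nonneg, ?_, ?_⟩
  · rw [e]; exact hi.integrable_mul hf.integrable hg.integrable
  · rw [e, hi.integral_fun_mul_eq_mul_integral hf.integrable.1 hg.integrable.1,
      Real.mul_rpow hf.nonneg hg.nonneg]
    exact mul_le_mul hf.le hg.le (integral_nonneg fun ω => by positivity)
      (Real.rpow_nonneg hf.nonneg _)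

end MomentBound

/-- The constant of the martingale moment inequality. -/
noncomputable def martConst (q : ℝ) : ℝ := 4 * ((1 + 2 * q) ^ q + 2 * q ^ 2)

theorem one_le_martConst (hq : 2 ≤ q) : 1 ≤ martConst q := by
  have hpos : (1 : ℝ) ≤ (1 + 2 * q) ^ q := Real.one_le_rpow (by linarith) (by linarith)
  unfold martConst
  nlinarith [sq_nonneg q]

/-- The unweighted inequality at `|a|/√V` and `|b|/√h`: with `V` and `h` the moment bounds of `a`
and `b`, each normalised term integrates to at most `1`. This replaces Hölder's inequality. -/
theorem rpow_sub_two_mul_sq_le_weighted (hq : 2 ≤ q) {V h : ℝ} (hV : 0 < V) (hh : 0 < h)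
    (a b : ℝ) :
    |a| ^ (q - 2) * b ^ 2 ≤
      V ^ (q / 2 - 1) * h * ((V ^ (q / 2))⁻¹ * |a| ^ q + (h ^ (q / 2))⁻¹ * |b| ^ q) := by
  have key : ∀ W : ℝ, 0 < W → ∀ r : ℝ, (√W) ^ r = W ^ (r / 2) := fun W hW r => by
    rw [Real.sqrt_eq_rpow, ← Real.rpow_mul hW.le]; congr 1; ring
  have h1 := rpow_sub_two_mul_sq_le hq (s := |a| / √V) (t := |b| / √h) (by positivity)
    (by positivity)
  rw [Real.div_rpow (abs_nonneg _) (Real.sqrt_nonneg _),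
    Real.div_rpow (abs_nonneg _) (Real.sqrt_nonneg _),
    Real.div_rpow (abs_nonneg _) (Real.sqrt_nonneg _), div_pow, Real.sq_sqrt hh.le, sq_abs,
    key V hV, key V hV, key h hh, show (q - 2) / 2 = q / 2 - 1 by ring] at h1
  have hc : 0 < V ^ (q / 2 - 1) * h := by positivity
  have hV' : 0 < V ^ (q / 2 - 1) := by positivity
  have h2 := mul_le_mul_of_nonneg_left h1 hc.le
  calc |a| ^ (q - 2) * b ^ 2
      = V ^ (q / 2 - 1) * h * (|a| ^ (q - 2) / V ^ (q / 2 - 1) * (b ^ 2 / h)) := by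
        field_simp
    _ ≤ _ := h2
    _ = _ := by ring

theorem rpow_sub_one_mul_le (hq : 2 ≤ q) (a b : ℝ) :
    |(|a| ^ (q - 2) * a * b)| ≤ |a| ^ q + |b| ^ q + |a| ^ q := by
  have h0 : (0 : ℝ) ≤ |a| ^ (q - 2) := by positivity
  have h1 := rpow_sub_two_mul_sq_le hq (abs_nonneg a) (abs_nonneg b)
  have h2 : |a| ^ (q - 2) * |a| ^ 2 ≤ |a| ^ q := by
    rcases eq_or_ne a 0 with rfl | ha
    · simp; positivity
    · rw [abs_rpow_split q ha, sq_abs]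
  rw [abs_mul, abs_mul, abs_of_nonneg h0]
  have h3 : |a| * |b| ≤ |b| ^ 2 + |a| ^ 2 := by nlinarith [sq_nonneg (|a| - |b|), sq_nonneg (|a| + |b|)]
  calc |a| ^ (q - 2) * |a| * |b| = |a| ^ (q - 2) * (|a| * |b|) := by ring
    _ ≤ |a| ^ (q - 2) * (|b| ^ 2 + |a| ^ 2) := by gcongr
    _ = |a| ^ (q - 2) * |b| ^ 2 + |a| ^ (q - 2) * |a| ^ 2 := by ring
    _ ≤ _ := by linarith

/-- Integrating the expansion of `|S + D|^q` removes the linear term by orthogonality. The remainder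
is absorbed in the power `q/2` of a sum, so squared norms add up to a constant on the new increment
only, which keeps the constant stable under iteration. -/
theorem integral_abs_add_rpow_le (hq : 2 ≤ q) {S D : Ω → ℝ} {V h : ℝ}
    (hS : MomentBound μ q S V) (hD : MomentBound μ q D h)
    (hSD : ∫ ω, |S ω| ^ (q - 2) * S ω * D ω ∂μ = 0) (hV : 0 < V) (hh : 0 < h) :
    ∫ ω, |S ω + D ω| ^ q ∂μ ≤ (V + martConst q * h) ^ (q / 2) := by
  have hSm := hS.measurable
  have hDm := hD.measurable
  set C : ℝ := (1 + 2 * q) ^ q + 2 * q ^ 2 with hC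
  have hC0 : 0 ≤ C := by positivity
  have i1 : Integrable (fun ω => |S ω| ^ (q - 2) * S ω * D ω) μ := by
    refine Integrable.mono' ((hS.integrable.add hD.integrable).add hS.integrable)
      (by fun_prop) (Filter.Eventually.of_forall fun ω => ?_)
    exact rpow_sub_one_mul_le hq _ _
  have i3 := ((hS.integrable.const_mul (V ^ (q / 2))⁻¹).add
      (hD.integrable.const_mul (h ^ (q / 2))⁻¹)).const_mul (V ^ (q / 2 - 1) * h)
  have i2 : Integrable (fun ω => |S ω| ^ (q - 2) * D ω ^ 2) μ := by
    refine Integrable.mono' i3 (by fun_prop) (Filter.Eventually.of_forall fun ω => ?_)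
    rw [Real.norm_of_nonneg (by positivity)]
    exact rpow_sub_two_mul_sq_le_weighted hq hV hh _ _
  have b2 : ∫ ω, |S ω| ^ (q - 2) * D ω ^ 2 ∂μ ≤ 2 * (V ^ (q / 2 - 1) * h) := by
    refine (integral_mono i2 i3 fun ω =>
      rpow_sub_two_mul_sq_le_weighted hq hV hh _ _).trans ?_
    simp only [Pi.add_apply]
    rw [integral_const_mul, integral_add (hS.integrable.const_mul _) (hD.integrable.const_mul _),
      integral_const_mul, integral_const_mul]
    have a1 : (V ^ (q / 2))⁻¹ * ∫ ω, |S ω| ^ q ∂μ ≤ 1 := by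
      rw [inv_mul_le_iff₀ (by positivity), mul_one]; exact hS.le
    have a2 : (h ^ (q / 2))⁻¹ * ∫ ω, |D ω| ^ q ∂μ ≤ 1 := by
      rw [inv_mul_le_iff₀ (by positivity), mul_one]; exact hD.le
    have : 0 ≤ V ^ (q / 2 - 1) * h := by positivity
    nlinarith
  have i4 := ((i2.add hD.integrable).const_mul C)
  calc ∫ ω, |S ω + D ω| ^ q ∂μ
      ≤ ∫ ω, (|S ω| ^ q + q * (|S ω| ^ (q - 2) * S ω * D ω) +
          C * (|S ω| ^ (q - 2) * D ω ^ 2 + |D ω| ^ q)) ∂μ := by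
        refine integral_mono (integrable_abs_add_rpow (by linarith) hSm hDm hS.integrable
          hD.integrable) ((hS.integrable.add (i1.const_mul q)).add i4) fun ω => ?_
        exact abs_add_rpow_le hq _ _
    _ = ∫ ω, |S ω| ^ q ∂μ + C * (∫ ω, |S ω| ^ (q - 2) * D ω ^ 2 ∂μ + ∫ ω, |D ω| ^ q ∂μ) := by
        rw [integral_add, integral_add, integral_const_mul, integral_const_mul, integral_add, hSD]
        · ring
        · exact i2
        · exact hD.integrable
        · exact hS.integrable
        · exact i1.const_mul q
        · exact hS.integrable.add (i1.const_mul q)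
        · exact i4
    _ ≤ V ^ (q / 2) + C * (2 * (V ^ (q / 2 - 1) * h) + h ^ (q / 2)) := by
        gcongr
        · exact hS.le
        · exact hD.le
    _ ≤ V ^ (q / 2) + martConst q / 2 * (V ^ (q / 2 - 1) * h + h ^ (q / 2)) := by
        have : 0 ≤ h ^ (q / 2) := by positivity
        unfold martConst
        rw [← hC]
        nlinarith
    _ ≤ _ := add_rpow_lower (by linarith) hV hh (one_le_martConst hq)

theorem MomentBound.add_orthogonal (hq : 2 ≤ q) {S D : Ω → ℝ} {V h : ℝ}
    (hS : MomentBound μ q S V) (hD : MomentBound μ q D h)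
    (hSD : ∫ ω, |S ω| ^ (q - 2) * S ω * D ω ∂μ = 0) :
    MomentBound μ q (fun ω => S ω + D ω) (V + martConst q * h) := by
  have hC := one_le_martConst hq
  refine ⟨hS.measurable.add hD.measurable,
    add_nonneg hS.nonneg (mul_nonneg (by linarith) hD.nonneg),
    integrable_abs_add_rpow (by linarith) hS.measurable hD.measurable hS.integrable hD.integrable,
    ?_⟩
  -- The weights require positive `V` and `h`; both are enlarged by `δ`, which then tends to `0`.
  have hlim : Filter.Tendsto (fun δ : ℝ => ((V + δ) + martConst q * (h + δ)) ^ (q / 2))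
      (nhdsWithin 0 (Set.Ioi 0)) (nhds ((V + martConst q * h) ^ (q / 2))) := by
    have hc : ContinuousAt (fun δ : ℝ => ((V + δ) + martConst q * (h + δ)) ^ (q / 2)) 0 :=
      ContinuousAt.rpow_const (by fun_prop) (Or.inr (by linarith))
    have := hc.tendsto.mono_left (nhdsWithin_le_nhds (s := Set.Ioi (0 : ℝ)))
    simpa using this
  refine ge_of_tendsto hlim ?_
  filter_upwards [self_mem_nhdsWithin] with δ hδ
  have hδ' : 0 < δ := hδ
  have := hS.nonneg
  have := hD.nonneg
  exact integral_abs_add_rpow_le hq (hS.mono (by linarith) (by linarith))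
    (hD.mono (by linarith) (by linarith)) hSD (by linarith) (by linarith)

/-- Moment inequality for the martingale `∑ ξ_s W_s`. -/
theorem momentBound_sum_mul [IsProbabilityMeasure μ] {ι : Type*} [LinearOrder ι] (hq : 2 ≤ q)
    (ξ W : ι → Ω → ℝ) (m : ℝ) (w : ι → ℝ) (F : Finset ι)
    (hξ : ∀ s ∈ F, MomentBound μ q (ξ s) m) (hW : ∀ s ∈ F, MomentBound μ q (W s) (w s))
    (hmean : ∀ s ∈ F, ∫ ω, ξ s ω ∂μ = 0)
    (hind : ∀ s ∈ F, IndepFun (ξ s)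
      (fun ω => (∑ u ∈ F with u < s, ξ u ω * W u ω, W s ω)) μ) :
    MomentBound μ q (fun ω => ∑ s ∈ F, ξ s ω * W s ω) (martConst q * m * ∑ s ∈ F, w s) := by
  have hC := one_le_martConst hq
  induction F using Finset.induction_on_max with
  | empty =>
    have := MomentBound.const (μ := μ) (q := q) 0
    simpa using this
  | insert a F ha ih =>
    have hnot : a ∉ F := fun h => lt_irrefl _ (ha a h)
    have ih' := ih (fun s hs => hξ s (Finset.mem_insert_of_mem hs))
      (fun s hs => hW s (Finset.mem_insert_of_mem hs))
      (fun s hs => hmean s (Finset.mem_insert_of_mem hs))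
      (fun s hs => by
        have := hind s (Finset.mem_insert_of_mem hs)
        rwa [Finset.filter_insert, if_neg (not_lt.2 (ha s hs).le)] at this)
    have hinda := hind a (Finset.mem_insert_self _ _)
    rw [Finset.filter_insert, if_neg (lt_irrefl a), Finset.filter_true_of_mem ha] at hinda
    have hξa := hξ a (Finset.mem_insert_self _ _)
    have hWa := hW a (Finset.mem_insert_self _ _)
    have hD : MomentBound μ q (fun ω => ξ a ω * W a ω) (m * w a) :=
      hξa.mul_indep hWa (hinda.comp (φ := id) (ψ := Prod.snd) measurable_id measurable_snd)
    -- The last `ξ a` is centred and independent of the pair (earlier partial sum, `W a`), which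
    -- makes the new increment orthogonal.
    have hSD : ∫ ω, |∑ s ∈ F, ξ s ω * W s ω| ^ (q - 2) * (∑ s ∈ F, ξ s ω * W s ω) *
        (ξ a ω * W a ω) ∂μ = 0 := by
      have hi : IndepFun (ξ a) (fun ω => |∑ s ∈ F, ξ s ω * W s ω| ^ (q - 2) *
          (∑ s ∈ F, ξ s ω * W s ω) * W a ω) μ :=
        hinda.comp (φ := id) (ψ := fun p : ℝ × ℝ => |p.1| ^ (q - 2) * p.1 * p.2)
          measurable_id (by fun_prop)
      have hm1 := ih'.measurable
      have hm2 := hWa.measurable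
      have := hi.integral_fun_mul_eq_mul_integral hξa.measurable.aestronglyMeasurable
        (by fun_prop)
      rw [hmean a (Finset.mem_insert_self _ _), zero_mul] at this
      rw [← this]
      congr 1
      ext ω
      ring
    have := ih'.add_orthogonal hq hD hSD
    simp only [Finset.sum_insert hnot]
    convert this using 1
    · ext ω; ring
    · ring

end MomentBound

/-! ### Quadratic forms in independent variables and products of moving averages -/

section QuadraticForm

variable {Ω : Type*} [MeasurableSpace Ω] {μ : Measure Ω} {q : ℝ}

/-- Reduction to finite blocks: zero extension from `T` does not change the value of `ψ`. Statistics
of the past can then be written as functions of the whole noise sequence. -/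
theorem iIndepFun.indepFun_of_dependsOn {ι β : Type*} [DecidableEq ι] [MeasurableSpace β]
    {e : ι → Ω → ℝ} (h : iIndepFun e μ) (hm : ∀ i, Measurable (e i)) {s : ι} {T : Finset ι}
    (hs : s ∉ T) {ψ : (ι → ℝ) → β} (hψ : Measurable ψ)
    (hdep : ∀ g g' : ι → ℝ, (∀ u ∈ T, g u = g' u) → ψ g = ψ g') :
    IndepFun (e s) (fun ω => ψ (fun u => e u ω)) μ := by
  have hi := h.indepFun_finset {s} T (by simpa using hs) hm
  have hext : Measurable fun (g : T → ℝ) (u : ι) => if hu : u ∈ T then g ⟨u, hu⟩ else 0 := by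
    refine measurable_pi_lambda _ fun u => ?_
    by_cases hu : u ∈ T
    · simpa [hu] using measurable_pi_apply _
    · simp [hu]
  have hev : Measurable fun g : ({s} : Finset ι) → ℝ => g ⟨s, Finset.mem_singleton_self s⟩ :=
    measurable_pi_apply _
  refine (hi.comp hev (hψ.comp hext)).congr (Filter.EventuallyEq.refl _ _)
    (Filter.Eventually.of_forall fun ω => hdep _ _ fun u hu => ?_)
  simp [hu]

theorem sum_sum_eq_diag_add {ι : Type*} [LinearOrder ι] (F : Finset ι) (f : ι → ι → ℝ) :
    ∑ s ∈ F, ∑ u ∈ F, f s u =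
      ∑ s ∈ F, f s s + ∑ s ∈ F, ∑ u ∈ F with u < s, (f s u + f u s) := by
  have h1 : ∀ s ∈ F, ∑ u ∈ F, f s u = f s s + ((∑ u ∈ F with u < s, f s u) +
      ∑ u ∈ F with s < u, f s u) := fun s hs => by
    rw [Finset.sum_filter, Finset.sum_filter, ← Finset.sum_add_distrib]
    have : f s s = ∑ u ∈ F, if u = s then f s u else 0 := by
      simp [hs]
    rw [this, ← Finset.sum_add_distrib]
    refine Finset.sum_congr rfl fun u _ => ?_
    rcases lt_trichotomy u s with h | h | h
    · simp [h, h.ne, h.not_gt]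
    · simp [h]
    · simp [h, h.ne', h.not_gt]
  rw [Finset.sum_congr rfl h1, Finset.sum_add_distrib, Finset.sum_add_distrib]
  congr 1
  simp only [Finset.sum_add_distrib]
  congr 1
  simp only [Finset.sum_filter]
  rw [Finset.sum_comm]

/-- Fatou's lemma; it carries bounds for finite quadratic forms over to infinite moving averages. -/
theorem MomentBound.of_tendsto {κ : Type*} {l : Filter κ} [l.NeBot] [l.IsCountablyGenerated]
    {f : κ → Ω → ℝ} {g : Ω → ℝ} {V : ℝ} (hq : 0 ≤ q) (hf : ∀ i, MomentBound μ q (f i) V)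
    (hg : Measurable g)
    (hlim : ∀ᵐ ω ∂μ, Filter.Tendsto (fun i => f i ω) l (nhds (g ω))) :
    MomentBound μ q g V := by
  obtain ⟨i₀⟩ := l.nonempty_of_neBot
  have hV := (hf i₀).nonneg
  have hle : ∫⁻ ω, ENNReal.ofReal (|g ω| ^ q) ∂μ ≤ ENNReal.ofReal (V ^ (q / 2)) := by
    have h1 : ∀ᵐ ω ∂μ, ENNReal.ofReal (|g ω| ^ q) =
        Filter.liminf (fun i => ENNReal.ofReal (|f i ω| ^ q)) l := by
      filter_upwards [hlim] with ω hω
      refine (Filter.Tendsto.liminf_eq ?_).symm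
      exact (ENNReal.continuous_ofReal.tendsto _).comp
        ((hω.abs).rpow_const (Or.inr hq))
    rw [lintegral_congr_ae h1]
    refine (lintegral_liminf_le' fun i =>
      ((measurable_abs_rpow (hf i).measurable q).ennreal_ofReal).aemeasurable).trans ?_
    refine Filter.liminf_le_of_le (by isBoundedDefault) fun b hb => ?_
    obtain ⟨i, hi⟩ := hb.exists
    refine hi.trans ?_
    rw [← ofReal_integral_eq_lintegral_ofReal (hf i).integrable
      (Filter.Eventually.of_forall fun ω => by positivity)]
    exact ENNReal.ofReal_le_ofReal (hf i).le
  have hint : Integrable (fun ω => |g ω| ^ q) μ := by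
    refine ⟨(measurable_abs_rpow hg q).aestronglyMeasurable, ?_⟩
    rw [hasFiniteIntegral_iff_ofReal (Filter.Eventually.of_forall fun ω => by positivity)]
    exact hle.trans_lt ENNReal.ofReal_lt_top
  refine ⟨hg, hV, hint, ?_⟩
  rw [← ofReal_integral_eq_lintegral_ofReal hint
      (Filter.Eventually.of_forall fun ω => by positivity)] at hle
  exact (ENNReal.ofReal_le_ofReal_iff (by positivity)).1 hle

theorem sum_shift_le_tsum {f : ℤ → ℝ} (hf : Summable f) (h0 : ∀ n, 0 ≤ f n) (t : ℤ)
    (F : Finset ℤ) : ∑ s ∈ F, f (t - s) ≤ ∑' n, f n := by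
  rw [← (Equiv.subLeft t).tsum_eq f]
  exact ((Equiv.subLeft t).summable_iff.2 hf).sum_le_tsum F fun _ _ => h0 _

theorem sum_shift_le_tsum' {f : ℤ → ℝ} (hf : Summable f) (h0 : ∀ n, 0 ≤ f n) (t : ℤ)
    (F : Finset ℤ) : ∑ s ∈ F, f (s - t) ≤ ∑' n, f n := by
  rw [← (Equiv.subRight t).tsum_eq f]
  exact ((Equiv.subRight t).summable_iff.2 hf).sum_le_tsum F fun _ _ => h0 _

/-- The Frobenius norm of the Gram matrix of two windows of moving averages. -/
theorem sum_sq_window_le {β c : ℤ → ℝ} (hβ : Summable fun n => β n ^ 2)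
    (hc : Summable fun n => |c n|) (T F : Finset ℤ) :
    ∑ s ∈ F, ∑ u ∈ F, (∑ t ∈ T, β (t - s) * c (t - u)) ^ 2 ≤
      T.card * ((∑' n, |c n|) ^ 2 * ∑' n, β n ^ 2) := by
  have hc0 : 0 ≤ ∑' n, |c n| := tsum_nonneg fun _ => abs_nonneg _
  have hβ0 : 0 ≤ ∑' n, β n ^ 2 := tsum_nonneg fun _ => sq_nonneg _
  have h1 : ∀ s ∈ F, ∀ u ∈ F, (∑ t ∈ T, β (t - s) * c (t - u)) ^ 2 ≤
      (∑ t ∈ T, β (t - s) ^ 2 * |c (t - u)|) * ∑' n, |c n| := fun s _ u _ => by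
    -- Cauchy–Schwarz after splitting `β c` as `(β |c|^{1/2}) · |c|^{1/2}` up to sign, so that only
    -- `c` pays an `ℓ¹` norm.
    have := Finset.sum_sq_le_sum_mul_sum_of_sq_le_mul T (r := fun t => β (t - s) * c (t - u))
      (f := fun t => β (t - s) ^ 2 * |c (t - u)|) (g := fun t => |c (t - u)|)
      (fun _ _ => by positivity) (fun _ _ => by positivity)
      (fun t _ => by rw [mul_pow, mul_assoc, abs_mul_abs_self, sq (c _)])
    refine this.trans ?_
    gcongr
    · exact sum_shift_le_tsum' hc (fun _ => abs_nonneg _) u T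
  calc ∑ s ∈ F, ∑ u ∈ F, (∑ t ∈ T, β (t - s) * c (t - u)) ^ 2
      ≤ ∑ s ∈ F, ∑ u ∈ F, (∑ t ∈ T, β (t - s) ^ 2 * |c (t - u)|) * ∑' n, |c n| :=
        Finset.sum_le_sum fun s hs => Finset.sum_le_sum fun u hu => h1 s hs u hu
    _ = (∑ t ∈ T, (∑ s ∈ F, β (t - s) ^ 2) * ∑ u ∈ F, |c (t - u)|) * ∑' n, |c n| := by
        simp only [← Finset.sum_mul]
        congr 1
        simp only [Finset.sum_mul_sum]
        rw [Finset.sum_comm]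
        rw [Finset.sum_congr rfl fun u _ => Finset.sum_comm]
        rw [Finset.sum_comm]
        exact Finset.sum_congr rfl fun t _ => Finset.sum_comm
    _ ≤ (∑ t ∈ T, (∑' n, β n ^ 2) * ∑' n, |c n|) * ∑' n, |c n| := by
        gcongr with t ht
        · exact sum_shift_le_tsum hβ (fun _ => sq_nonneg _) t F
        · exact sum_shift_le_tsum hc (fun _ => abs_nonneg _) t F
    _ = _ := by
        rw [Finset.sum_const, nsmul_eq_mul]; ring

theorem summable_sq_of_summable_abs {β : ℤ → ℝ} (hβ : Summable fun n => |β n|) :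
    Summable fun n => β n ^ 2 := by
  refine Summable.of_nonneg_of_le (fun n => sq_nonneg _) (fun n => ?_)
    (hβ.mul_left (∑' n, |β n|))
  rw [← sq_abs, sq]
  exact mul_le_mul_of_nonneg_right (hβ.le_tsum n fun _ _ => abs_nonneg _) (abs_nonneg _)

variable [IsProbabilityMeasure μ] {ι : Type*} [LinearOrder ι] {e : ι → Ω → ℝ}

theorem momentBound_linear_form (hq : 2 ≤ q) (hind : iIndepFun e μ)
    (hm : ∀ i, Measurable (e i)) (hmean : ∀ i, ∫ ω, e i ω ∂μ = 0) {m : ℝ}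
    (he : ∀ i, MomentBound μ q (e i) m) (F : Finset ι) (c : ι → ℝ) :
    MomentBound μ q (fun ω => ∑ s ∈ F, e s ω * c s) (martConst q * m * ∑ s ∈ F, c s ^ 2) := by
  refine momentBound_sum_mul hq e (fun s _ => c s) m (fun s => c s ^ 2) F (fun s _ => he s)
    (fun s _ => MomentBound.const (c s)) (fun s _ => hmean s) fun s _ => ?_
  refine iIndepFun.indepFun_of_dependsOn hind hm (s := s) (T := {u ∈ F | u < s}) (by simp)
    (ψ := fun g => (∑ u ∈ F with u < s, g u * c u, c s)) (by fun_prop) fun g g' hg => ?_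
  rw [Finset.sum_congr rfl fun u hu => by rw [hg u hu]]

/-- The constant of the moment inequality for quadratic forms. -/
noncomputable def quadConst (q m m₂ : ℝ) : ℝ :=
  4 * (martConst q * m₂ + 4 * (martConst q * m) ^ 2)

/-- Whittle's moment inequality for quadratic forms in independent variables. -/
theorem momentBound_quadratic_form (hq : 2 ≤ q) (hind : iIndepFun e μ)
    (hm : ∀ i, Measurable (e i)) (hmean : ∀ i, ∫ ω, e i ω ∂μ = 0) {m m₂ v : ℝ}
    (he : ∀ i, MomentBound μ q (e i) m)
    (he2 : ∀ i, MomentBound μ q (fun ω => e i ω ^ 2 - v) m₂)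
    (hvar : ∀ i, ∫ ω, (e i ω ^ 2 - v) ∂μ = 0) (F : Finset ι) (M : ι → ι → ℝ) :
    MomentBound μ q (fun ω => ∑ s ∈ F, ∑ u ∈ F, M s u * (e s ω * e u ω) - ∑ s ∈ F, M s s * v)
      (quadConst q m m₂ * ∑ s ∈ F, ∑ u ∈ F, M s u ^ 2) := by
  have hC := one_le_martConst hq
  by_cases hF : F = ∅
  · subst hF
    have := MomentBound.const (μ := μ) (q := q) 0
    simpa using this
  obtain ⟨i₀, -⟩ := Finset.nonempty_iff_ne_empty.2 hF
  have hm0 := (he i₀).nonneg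
  have hm20 := (he2 i₀).nonneg
  have hdiag := momentBound_sum_mul hq (fun s ω => e s ω ^ 2 - v) (fun s _ => M s s) m₂
    (fun s => M s s ^ 2) F (fun s _ => he2 s) (fun s _ => MomentBound.const _)
    (fun s _ => hvar s) (fun s _ => by
      have := iIndepFun.indepFun_of_dependsOn hind hm (s := s) (T := {u ∈ F | u < s}) (by simp)
        (ψ := fun g => (∑ u ∈ F with u < s, (g u ^ 2 - v) * M u u, M s s)) (by fun_prop)
        fun g g' hg => by rw [Finset.sum_congr rfl fun u hu => by rw [hg u hu]]
      exact this.comp (φ := fun x : ℝ => x ^ 2 - v) (ψ := id) (by fun_prop) measurable_id)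
  -- Off the diagonal, the form is a martingale in `s`: `e s` multiplies a linear form in the
  -- earlier variables, whose moments come from the same martingale inequality.
  have hoff := momentBound_sum_mul hq e
    (fun s ω => ∑ u ∈ F with u < s, e u ω * (M s u + M u s)) m
    (fun s => martConst q * m * ∑ u ∈ F with u < s, (M s u + M u s) ^ 2) F (fun s _ => he s)
    (fun s _ => momentBound_linear_form hq hind hm hmean he _ _)
    (fun s _ => hmean s) (fun s _ => by
      refine iIndepFun.indepFun_of_dependsOn hind hm (s := s) (T := {u ∈ F | u < s}) (by simp)
        (ψ := fun g => (∑ u ∈ F with u < s, g u * ∑ w ∈ F with w < u, g w * (M u w + M w u),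
          ∑ u ∈ F with u < s, g u * (M s u + M u s))) (by fun_prop) fun g g' hg => ?_
      rw [Prod.mk.injEq]
      constructor
      · refine Finset.sum_congr rfl fun u hu => ?_
        rw [hg u hu]
        congr 1
        refine Finset.sum_congr rfl fun w hw => ?_
        rw [hg w]
        rw [Finset.mem_filter] at hu hw ⊢
        exact ⟨hw.1, hw.2.trans hu.2⟩
      · exact Finset.sum_congr rfl fun u hu => by rw [hg u hu])
  have hadd := hdiag.add hoff hq
  have hsum : martConst q * m₂ * ∑ s ∈ F, M s s ^ 2 + martConst q * m * ∑ s ∈ F,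
      (martConst q * m * ∑ u ∈ F with u < s, (M s u + M u s) ^ 2) ≤
      (martConst q * m₂ + 4 * (martConst q * m) ^ 2) * ∑ s ∈ F, ∑ u ∈ F, M s u ^ 2 := by
    have hdec := sum_sum_eq_diag_add F (fun s u => M s u ^ 2)
    have h0 : 0 ≤ ∑ s ∈ F, M s s ^ 2 := Finset.sum_nonneg fun _ _ => sq_nonneg _
    have h1 : 0 ≤ ∑ s ∈ F, ∑ u ∈ F with u < s, (M s u ^ 2 + M u s ^ 2) :=
      Finset.sum_nonneg fun _ _ => Finset.sum_nonneg fun _ _ => by positivity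
    have h2 : ∑ s ∈ F, ∑ u ∈ F with u < s, (M s u + M u s) ^ 2 ≤
        2 * ∑ s ∈ F, ∑ u ∈ F with u < s, (M s u ^ 2 + M u s ^ 2) := by
      rw [Finset.mul_sum]
      refine Finset.sum_le_sum fun s _ => ?_
      rw [Finset.mul_sum]
      exact Finset.sum_le_sum fun u _ => by nlinarith [sq_nonneg (M s u - M u s)]
    rw [← Finset.mul_sum, ← mul_assoc, add_mul]
    have h3 : 0 ≤ martConst q * m₂ := mul_nonneg (by linarith) hm20
    have h4 : 0 ≤ (martConst q * m) ^ 2 := sq_nonneg _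
    have h5 : martConst q * m₂ * ∑ s ∈ F, M s s ^ 2 ≤
        martConst q * m₂ * ∑ s ∈ F, ∑ u ∈ F, M s u ^ 2 :=
      mul_le_mul_of_nonneg_left (by linarith) h3
    have h6 : (martConst q * m) ^ 2 * ∑ s ∈ F, ∑ u ∈ F with u < s, (M s u + M u s) ^ 2 ≤
        (martConst q * m) ^ 2 * (4 * ∑ s ∈ F, ∑ u ∈ F, M s u ^ 2) :=
      mul_le_mul_of_nonneg_left (by linarith) h4
    nlinarith
  have hfin := hadd.mono (W := quadConst q m m₂ * ∑ s ∈ F, ∑ u ∈ F, M s u ^ 2) (by linarith : 0 ≤ q) (by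
    unfold quadConst
    linarith)
  convert hfin using 1
  ext ω
  rw [sum_sum_eq_diag_add F fun s u => M s u * (e s ω * e u ω), add_sub_right_comm,
    ← Finset.sum_sub_distrib]
  congr 1
  · exact Finset.sum_congr rfl fun s _ => by ring
  · refine Finset.sum_congr rfl fun s _ => ?_
    rw [Finset.mul_sum]
    exact Finset.sum_congr rfl fun u _ => by ring

/-- Products of two moving averages, summed over a window. -/
theorem momentBound_sum_movingAverage {e : ℤ → Ω → ℝ} (hq : 2 ≤ q) (hind : iIndepFun e μ)
    (hm : ∀ i, Measurable (e i)) (hmean : ∀ i, ∫ ω, e i ω ∂μ = 0) {m m₂ v : ℝ}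
    (he : ∀ i, MomentBound μ q (e i) m)
    (he2 : ∀ i, MomentBound μ q (fun ω => e i ω ^ 2 - v) m₂)
    (hvar : ∀ i, ∫ ω, (e i ω ^ 2 - v) ∂μ = 0) {β c : ℤ → ℝ}
    (hβ : Summable fun n => |β n|) (hc : Summable fun n => |c n|) (T : Finset ℤ)
    {y z : ℤ → Ω → ℝ} (hym : ∀ t, Measurable (y t)) (hzm : ∀ t, Measurable (z t))
    (hy : ∀ t, ∀ᵐ ω ∂μ, HasSum (fun s => β (t - s) * e s ω) (y t ω))
    (hz : ∀ t, ∀ᵐ ω ∂μ, HasSum (fun s => c (t - s) * e s ω) (z t ω)) :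
    MomentBound μ q (fun ω => ∑ t ∈ T, (y t ω * z t ω - v * ∑' n, β n * c n))
      (quadConst q m m₂ * (T.card * ((∑' n, |c n|) ^ 2 * ∑' n, β n ^ 2))) := by
  have hC := one_le_martConst hq
  have hm20 := (he2 0).nonneg
  have hQ : 0 ≤ quadConst q m m₂ := by
    unfold quadConst
    have := mul_nonneg (by linarith : 0 ≤ martConst q) hm20
    positivity
  have hβ2 := summable_sq_of_summable_abs hβ
  have hc2 := summable_sq_of_summable_abs hc
  -- Truncating both averages to the innovations in `F` leaves a quadratic form with matrix `∑_t
  -- β(t-s) c(t-u)`. Its bound does not depend on `F`, so the limit over `F` inherits it.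
  refine MomentBound.of_tendsto (l := (Filter.atTop : Filter (Finset ℤ))) (by linarith)
    (f := fun F ω => ∑ s ∈ F, ∑ u ∈ F, (∑ t ∈ T, β (t - s) * c (t - u)) * (e s ω * e u ω) -
      ∑ s ∈ F, (∑ t ∈ T, β (t - s) * c (t - s)) * v) (fun F =>
      (momentBound_quadratic_form hq hind hm hmean he he2 hvar F _).mono (by linarith)
        (mul_le_mul_of_nonneg_left (sum_sq_window_le hβ2 hc T F) hQ)) (by fun_prop) ?_
  have hβc : Summable fun n => β n * c n := by
    refine Summable.of_norm_bounded (hβ2.add hc2) fun n => ?_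
    rw [Real.norm_eq_abs, abs_le]
    constructor <;> nlinarith [sq_nonneg (β n - c n), sq_nonneg (β n + c n)]
  filter_upwards [ae_all_iff.2 hy, ae_all_iff.2 hz] with ω h1 h2
  have h3 : Filter.Tendsto (fun F : Finset ℤ => ∑ t ∈ T,
      ((∑ s ∈ F, β (t - s) * e s ω) * (∑ s ∈ F, c (t - s) * e s ω) -
        v * ∑ s ∈ F, β (t - s) * c (t - s))) Filter.atTop
      (nhds (∑ t ∈ T, (y t ω * z t ω - v * ∑' n, β n * c n))) := by
    refine tendsto_finsetSum _ fun t _ => ?_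
    refine Filter.Tendsto.sub (Filter.Tendsto.mul (h1 t) (h2 t)) (Filter.Tendsto.const_mul v ?_)
    have := (Equiv.subLeft t).hasSum_iff.2 hβc.hasSum
    exact this
  refine h3.congr fun F => ?_
  rw [Finset.sum_sub_distrib]
  congr 1
  · rw [Finset.sum_congr rfl fun t _ => Finset.sum_mul_sum F F _ _, Finset.sum_comm]
    refine Finset.sum_congr rfl fun s _ => ?_
    rw [Finset.sum_comm]
    refine Finset.sum_congr rfl fun u _ => ?_
    rw [Finset.sum_mul]
    exact Finset.sum_congr rfl fun t _ => by ring
  · simp only [Finset.mul_sum, Finset.sum_mul]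
    rw [Finset.sum_comm]
    exact Finset.sum_congr rfl fun s _ => Finset.sum_congr rfl fun t _ => by ring

end QuadraticForm

/-! ### Convolution inverses and Baxter's bound for finite Toeplitz systems -/

section Convolution

/-- A one-sided absolutely summable sequence `α` on `ℤ` with convolution inverse `b`. -/
structure IsInversePair (α b : ℤ → ℝ) : Prop where
  summable_left : Summable fun n => |α n|
  summable_right : Summable fun n => |b n|
  left_neg : ∀ n, n < 0 → α n = 0
  right_neg : ∀ n, n < 0 → b n = 0
  conv : ∀ n, HasSum (fun i => α i * b (n - i)) (if n = 0 then 1 else 0)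

theorem summable_abs_shift {f : ℤ → ℝ} (hf : Summable fun n => |f n|) (t : ℤ) :
    Summable fun n => |f (n - t)| :=
  (Equiv.subRight t).summable_iff.2 hf

theorem tsum_abs_shift (f : ℤ → ℝ) (t : ℤ) : ∑' n, |f (n - t)| = ∑' n, |f n| :=
  (Equiv.subRight t).tsum_eq fun n => |f n|

theorem summable_mul_of_abs_le {f g : ℤ → ℝ} (hf : Summable fun n => |f n|) {B : ℝ}
    (hg : ∀ n, |g n| ≤ B) : Summable fun n => |f n * g n| := by
  refine Summable.of_nonneg_of_le (fun _ => abs_nonneg _) (fun n => ?_) (hf.mul_right B)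
  rw [abs_mul]
  exact mul_le_mul_of_nonneg_left (hg n) (abs_nonneg _)

theorem abs_tsum_mul_le {f g : ℤ → ℝ} (hf : Summable fun n => |f n|) {B : ℝ}
    (hg : ∀ n, |g n| ≤ B) : |∑' n, f n * g n| ≤ (∑' n, |f n|) * B := by
  have h := summable_mul_of_abs_le hf hg
  refine (norm_tsum_le_tsum_norm (f := fun n => f n * g n) h).trans ?_
  rw [← tsum_mul_right]
  refine h.tsum_le_tsum (fun n => ?_) (hf.mul_right B)
  rw [Real.norm_eq_abs, abs_mul]
  exact mul_le_mul_of_nonneg_left (hg n) (abs_nonneg _)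

theorem abs_le_tsum_abs {f : ℤ → ℝ} (hf : Summable fun n => |f n|) (n : ℤ) :
    |f n| ≤ ∑' n, |f n| := hf.le_tsum n fun _ _ => abs_nonneg _

/-- Summing a family of convolution-type series over a finite window. -/
theorem sum_abs_tsum_le {f : ℤ → ℝ} {g : ℤ → ℤ → ℝ} (hf : Summable fun i => |f i|) (J : Finset ℤ)
    {B : ℝ} (hB : ∀ i, f i ≠ 0 → ∑ n ∈ J, |g n i| ≤ B) :
    ∑ n ∈ J, |∑' i, f i * g n i| ≤ (∑' i, |f i|) * B := by
  have hle : ∀ n ∈ J, ∀ i, |f i * g n i| ≤ |f i| * B := fun n hn i => by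
    by_cases h0 : f i = 0
    · simp [h0]
    · rw [abs_mul]
      refine mul_le_mul_of_nonneg_left ?_ (abs_nonneg _)
      exact (Finset.single_le_sum (f := fun n => |g n i|) (fun _ _ => abs_nonneg _) hn).trans
        (hB i h0)
  have hs : ∀ n ∈ J, Summable fun i => |f i * g n i| := fun n hn =>
    Summable.of_nonneg_of_le (fun _ => abs_nonneg _) (hle n hn) (hf.mul_right B)
  calc ∑ n ∈ J, |∑' i, f i * g n i| ≤ ∑ n ∈ J, ∑' i, |f i * g n i| :=
        Finset.sum_le_sum fun n hn => norm_tsum_le_tsum_norm (f := fun i => f i * g n i) (hs n hn)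
    _ = ∑' i, ∑ n ∈ J, |f i * g n i| := (Summable.tsum_finsetSum hs).symm
    _ ≤ ∑' i, |f i| * B := by
        refine (summable_sum hs).tsum_le_tsum (fun i => ?_) (hf.mul_right B)
        simp only [abs_mul, ← Finset.mul_sum]
        by_cases h0 : f i = 0
        · simp [h0]
        · exact mul_le_mul_of_nonneg_left (hB i h0) (abs_nonneg _)
    _ = _ := tsum_mul_right

/-- The convolution of `U`, restricted to `[0, k]`, with `b`. -/
noncomputable def convWindow (b : ℤ → ℝ) (k : ℤ) (U : ℤ → ℝ) (n : ℤ) : ℝ :=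
  ∑ l ∈ Finset.Icc 0 k, U l * b (n - l)

variable {α b U : ℤ → ℝ} {k : ℤ}

theorem summable_convWindow (hb : Summable fun n => |b n|) (k : ℤ) (U : ℤ → ℝ) :
    Summable fun n => |convWindow b k U n| := by
  refine Summable.of_nonneg_of_le (fun _ => abs_nonneg _)
    (fun n => Finset.abs_sum_le_sum_abs _ _) (summable_sum fun l _ => ?_)
  simp only [abs_mul]
  exact (summable_abs_shift hb l).mul_left _

theorem tsum_abs_convWindow_le (hb : Summable fun n => |b n|) (k : ℤ) (U : ℤ → ℝ) :
    ∑' n, |convWindow b k U n| ≤ (∑ l ∈ Finset.Icc 0 k, |U l|) * ∑' n, |b n| := by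
  have hs : ∀ l ∈ Finset.Icc 0 k, Summable fun n => |U l * b (n - l)| := fun l _ => by
    simp only [abs_mul]
    exact (summable_abs_shift hb l).mul_left _
  refine ((summable_convWindow hb k U).tsum_le_tsum
    (fun n => Finset.abs_sum_le_sum_abs _ _) (summable_sum hs)).trans ?_
  rw [Summable.tsum_finsetSum hs, Finset.sum_mul]
  refine le_of_eq (Finset.sum_congr rfl fun l _ => ?_)
  simp only [abs_mul]
  rw [tsum_mul_left, tsum_abs_shift]

namespace IsInversePair

theorem convWindow_neg (h : IsInversePair α b) (k : ℤ) (U : ℤ → ℝ) {n : ℤ} (hn : n < 0) :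
    convWindow b k U n = 0 :=
  Finset.sum_eq_zero fun l hl => by
    rw [h.right_neg _ (by have := (Finset.mem_Icc.1 hl).1; omega), mul_zero]

/-- Deconvolution. -/
theorem hasSum_mul_convWindow (h : IsInversePair α b) {n : ℤ} (hn : n ∈ Finset.Icc 0 k) :
    HasSum (fun i => α i * convWindow b k U (n - i)) (U n) := by
  have h1 : HasSum (fun i => ∑ l ∈ Finset.Icc 0 k, U l * (α i * b (n - l - i)))
      (∑ l ∈ Finset.Icc 0 k, U l * if n - l = 0 then 1 else 0) :=
    hasSum_sum fun l _ => (h.conv (n - l)).mul_left (U l)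
  convert h1 using 1
  · ext i
    rw [convWindow, Finset.mul_sum]
    refine Finset.sum_congr rfl fun l _ => ?_
    rw [sub_right_comm]; ring
  · rw [Finset.sum_eq_single_of_mem n hn]
    · simp
    · intro l _ hl
      rw [if_neg (by omega), mul_zero]

theorem summable_prod_mul (h : IsInversePair α b) {β : ℤ → ℝ} (hβ : Summable fun n => |β n|)
    (n : ℤ) : Summable fun p : ℤ × ℤ => α p.1 * (β p.2 * b (p.2 - (n + p.1))) := by
  have h1 : Summable fun p : ℤ × ℤ => |α p.1| * |β p.2| :=
    h.summable_left.mul_of_nonneg hβ (fun _ => abs_nonneg _) (fun _ => abs_nonneg _)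
  refine Summable.of_norm_bounded (h1.mul_right (∑' n, |b n|)) fun p => ?_
  rw [Real.norm_eq_abs, abs_mul, abs_mul, ← mul_assoc]
  exact mul_le_mul_of_nonneg_left (abs_le_tsum_abs h.summable_right _) (by positivity)

/-- Correlation with `b` is undone by correlation with `α`, since `α * b` is the unit mass. Thus `β`
is recovered from the correlations that the normal equations set to zero. -/
theorem eq_tsum_correlation (h : IsInversePair α b) {β : ℤ → ℝ} (hβ : Summable fun n => |β n|)
    (n : ℤ) : β n = ∑' i, α i * ∑' l, β l * b (l - (n + i)) := by
  have hs := h.summable_prod_mul hβ n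
  have h1 : ∑' i, α i * ∑' l, β l * b (l - (n + i)) =
      ∑' i, ∑' l, α i * (β l * b (l - (n + i))) := by
    simp only [tsum_mul_left]
  rw [h1, ← hs.tsum_comm (f := fun i l => α i * (β l * b (l - (n + i))))]
  have h2 : ∀ l, ∑' i, α i * (β l * b (l - (n + i))) = β l * if l - n = 0 then 1 else 0 :=
    fun l => by
      rw [← (h.conv (l - n)).tsum_eq, ← tsum_mul_left]
      congr 1
      ext i
      rw [sub_add_eq_sub_sub]; ring
  simp only [h2]
  rw [tsum_eq_single n]
  · simp
  · intro l hl
    rw [if_neg (by omega), mul_zero]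

/-- Uniform `ℓ¹` bound for the solutions of the finite Toeplitz systems (Baxter). -/
theorem sum_abs_le_of_correlation_eq_zero (h : IsInversePair α b) {B : ℝ} {m : ℕ}
    (hB : ∀ n, |convWindow b k U n| ≤ B)
    (hF : ∀ j, 1 ≤ j → j ≤ k → ∑' l, convWindow b k U l * b (l - j) = 0)
    (hm : (∑' n, |α n|) * (∑' n, |if (m : ℤ) < n then α n else 0|) * (∑' n, |b n|) ^ 2 ≤ 1 / 2) :
    ∑ l ∈ Finset.Icc 0 k, |U l| ≤ 2 * ((∑' n, |α n|) * B * (m + 1)) := by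
  set β := convWindow b k U with hβdef
  set NA := ∑' n, |α n| with hNA
  set NB := ∑' n, |b n| with hNB
  set ε := ∑' n, |if (m : ℤ) < n then α n else 0| with hε
  set NU := ∑ l ∈ Finset.Icc 0 k, |U l| with hNU
  have hβ : Summable fun n => |β n| := summable_convWindow h.summable_right k U
  have hβU : ∑' n, |β n| ≤ NU * NB := tsum_abs_convWindow_le h.summable_right k U
  have hNA0 : 0 ≤ NA := tsum_nonneg fun _ => abs_nonneg _
  have hNB0 : 0 ≤ NB := tsum_nonneg fun _ => abs_nonneg _
  have hε0 : 0 ≤ ε := tsum_nonneg fun _ => abs_nonneg _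
  have hB0 : 0 ≤ B := (abs_nonneg _).trans (hB 0)
  have hαm : Summable fun n : ℤ => |if (m : ℤ) < n then α n else 0| :=
    Summable.of_nonneg_of_le (fun _ => abs_nonneg _)
      (fun n => by split_ifs <;> simp) h.summable_left
  have hU : ∀ n ∈ Finset.Icc 0 k, U n = ∑' i, α i * β (n - i) := fun n hn =>
    (h.hasSum_mul_convWindow hn).tsum_eq.symm
  have hUle : ∀ n ∈ Finset.Icc 0 k, |U n| ≤ NA * B := fun n hn => by
    rw [hU n hn]
    exact abs_tsum_mul_le h.summable_left fun _ => hB _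
  have hcorr : ∀ J : Finset ℤ, ∑ j ∈ J, |∑' l, β l * b (l - j)| ≤ NU * NB * NB := fun J =>
    (sum_abs_tsum_le hβ J fun l _ =>
      sum_shift_le_tsum h.summable_right (fun _ => abs_nonneg _) l J).trans
        (mul_le_mul_of_nonneg_right hβU hNB0)
  -- In the recovery formula for `β n`, indices `0 ≤ i ≤ m` meet correlations at `n + i ∈ [1, k]`,
  -- which vanish. Only the tail of `α` remains, hence the small factor `ε`.
  have hβlow : ∑ n ∈ Finset.Icc 1 (k - m), |β n| ≤ ε * (NU * NB * NB) := by
    have h1 : ∀ n ∈ Finset.Icc 1 (k - m), β n =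
        ∑' i, (if (m : ℤ) < i then α i else 0) * ∑' l, β l * b (l - (n + i)) := fun n hn => by
      rw [h.eq_tsum_correlation hβ n]
      congr 1
      ext i
      obtain ⟨hn1, hn2⟩ := Finset.mem_Icc.1 hn
      split_ifs with hi
      · rfl
      · rw [zero_mul]
        rcases lt_or_ge i 0 with hi0 | hi0
        · rw [h.left_neg i hi0, zero_mul]
        · rw [hF (n + i) (by omega) (by omega), mul_zero]
    rw [Finset.sum_congr rfl fun n hn => congrArg abs (h1 n hn)]
    refine sum_abs_tsum_le hαm _ fun i _ => ?_
    have := hcorr ((Finset.Icc 1 (k - m)).map (addRightEmbedding i))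
    rwa [Finset.sum_map] at this
  -- Deconvolution by the causal `α` uses `β` only at indices up to `k - m`; the index `0`, outside
  -- the normal equations, costs `B`.
  have hlow : ∑ n ∈ Finset.Icc 0 (k - m), |U n| ≤ NA * (B + ε * (NU * NB * NB)) := by
    have hsub : ∀ n ∈ Finset.Icc 0 (k - (m : ℤ)), n ∈ Finset.Icc 0 k := fun n hn => by
      rw [Finset.mem_Icc] at hn ⊢; omega
    rw [Finset.sum_congr rfl fun n hn => congrArg abs (hU n (hsub n hn))]
    refine sum_abs_tsum_le h.summable_left _ fun i hi => ?_
    have hi0 : 0 ≤ i := by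
      by_contra hneg
      exact hi (h.left_neg i (by omega))
    have h2 : ∑ n ∈ Finset.Icc 0 (k - (m : ℤ)), |β (n - i)| ≤
        ∑ n ∈ Finset.Icc 0 (k - (m : ℤ)), |β n| := by
      calc ∑ n ∈ Finset.Icc 0 (k - (m : ℤ)), |β (n - i)|
          = ∑ n ∈ (Finset.Icc 0 (k - (m : ℤ))).map (Equiv.subRight i).toEmbedding, |β n| := by
            rw [Finset.sum_map]; rfl
        _ = ∑ n ∈ (Finset.Icc 0 (k - (m : ℤ))).map (Equiv.subRight i).toEmbedding with 0 ≤ n,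
              |β n| := by
            rw [Finset.sum_filter]
            refine Finset.sum_congr rfl fun n _ => ?_
            split_ifs with hn
            · rfl
            · rw [hβdef, h.convWindow_neg k U (by omega), abs_zero]
        _ ≤ _ := by
            refine Finset.sum_le_sum_of_subset_of_nonneg (fun n hn => ?_) fun _ _ _ => abs_nonneg _
            simp only [Finset.mem_filter, Finset.mem_map, Finset.mem_Icc, Equiv.coe_toEmbedding,
              Equiv.subRight_apply] at hn ⊢
            obtain ⟨⟨x, hx, rfl⟩, hn⟩ := hn
            omega
    refine h2.trans ?_
    calc ∑ n ∈ Finset.Icc 0 (k - (m : ℤ)), |β n|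
        ≤ ∑ n ∈ insert 0 (Finset.Icc 1 (k - (m : ℤ))), |β n| := by
          refine Finset.sum_le_sum_of_subset_of_nonneg (fun n hn => ?_) fun _ _ _ => abs_nonneg _
          simp only [Finset.mem_insert, Finset.mem_Icc] at hn ⊢
          omega
      _ = |β 0| + ∑ n ∈ Finset.Icc 1 (k - (m : ℤ)), |β n| :=
          Finset.sum_insert (by simp)
      _ ≤ _ := add_le_add (hB 0) hβlow
  have hhigh : ∑ n ∈ (Finset.Ioc (k - m) k) ∩ Finset.Icc 0 k, |U n| ≤ m * (NA * B) := by
    refine (Finset.sum_le_card_nsmul _ _ _ fun n hn =>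
      hUle n (Finset.mem_inter.1 hn).2).trans ?_
    rw [nsmul_eq_mul]
    refine mul_le_mul_of_nonneg_right ?_ (by positivity)
    have := Finset.card_le_card (Finset.inter_subset_left (s₁ := Finset.Ioc (k - (m : ℤ)) k)
      (s₂ := Finset.Icc 0 k))
    rw [Int.card_Ioc] at this
    exact_mod_cast this.trans (by omega)
  have htot : NU ≤ ∑ n ∈ Finset.Icc 0 (k - (m : ℤ)), |U n| +
      ∑ n ∈ (Finset.Ioc (k - (m : ℤ)) k) ∩ Finset.Icc 0 k, |U n| := by
    rw [hNU, ← Finset.sum_union]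
    · refine Finset.sum_le_sum_of_subset_of_nonneg (fun n hn => ?_) fun _ _ _ => abs_nonneg _
      simp only [Finset.mem_union, Finset.mem_inter, Finset.mem_Icc, Finset.mem_Ioc] at hn ⊢
      omega
    · rw [Finset.disjoint_left]
      intro n hn hn'
      simp only [Finset.mem_inter, Finset.mem_Icc, Finset.mem_Ioc] at hn hn'
      omega
  have hNU0 : 0 ≤ NU := Finset.sum_nonneg fun _ _ => abs_nonneg _
  -- The at most `m` last entries cost `NA * B` each, so `NU ≤ NA * B * (m + 1) + NU / 2`; absorbing
  -- the last term gives the factor `2`.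
  have h5 : NA * ε * NB ^ 2 * NU ≤ 1 / 2 * NU := mul_le_mul_of_nonneg_right hm hNU0
  nlinarith

theorem exists_tail_le (h : IsInversePair α b) :
    ∃ m : ℕ, (∑' n, |α n|) * (∑' n, |if (m : ℤ) < n then α n else 0|) * (∑' n, |b n|) ^ 2
      ≤ 1 / 2 := by
  have hlim : Filter.Tendsto (fun m : ℕ => ∑' n : ℤ, |if (m : ℤ) < n then α n else 0|)
      Filter.atTop (nhds (∑' _ : ℤ, (0 : ℝ))) := by
    refine tendsto_tsum_of_dominated_convergence h.summable_left (fun n => ?_)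
      (Filter.Eventually.of_forall fun m n => ?_)
    · refine tendsto_const_nhds.congr' ?_
      filter_upwards [Filter.eventually_ge_atTop n.toNat] with m hm
      rw [if_neg (by omega), abs_zero]
    · rw [Real.norm_eq_abs, abs_abs]
      split_ifs <;> simp
  rw [tsum_zero] at hlim
  have h2 := (hlim.const_mul (∑' n, |α n|)).mul_const ((∑' n, |b n|) ^ 2)
  rw [mul_zero, zero_mul] at h2
  exact (h2.eventually_le_const (by norm_num : (0 : ℝ) < 1 / 2)).exists

end IsInversePair

end Convolution

/-! ### Passing from one-sided to two-sided sequences -/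

section ZeroExtension

/-- Extension of a one-sided sequence to `ℤ` by zero. -/
def zeroExt (f : ℕ → ℝ) (n : ℤ) : ℝ := if 0 ≤ n then f n.toNat else 0

@[simp] theorem zeroExt_natCast (f : ℕ → ℝ) (n : ℕ) : zeroExt f n = f n := by simp [zeroExt]

theorem zeroExt_neg (f : ℕ → ℝ) {n : ℤ} (hn : n < 0) : zeroExt f n = 0 := by
  rw [zeroExt, if_neg (by omega)]

theorem hasSum_int_iff_nat {f : ℤ → ℝ} (hf : ∀ n, n < 0 → f n = 0) {r : ℝ} :
    HasSum (fun n : ℕ => f n) r ↔ HasSum f r :=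
  Nat.cast_injective.hasSum_iff (g := ((↑) : ℕ → ℤ)) fun n hn => hf n (by
    by_contra h
    exact hn ⟨n.toNat, by simp; omega⟩)

theorem summable_abs_zeroExt {f : ℕ → ℝ} (hf : Summable fun n => |f n|) :
    Summable fun n => |zeroExt f n| := by
  obtain ⟨r, hr⟩ := hf
  refine ⟨r, (hasSum_int_iff_nat fun n hn => ?_).1 (by simpa using hr)⟩
  rw [zeroExt_neg f hn, abs_zero]

/-- The sequence `1, a₁, a₂, …`. -/
def consOne (a : ℕ → ℝ) : ℕ → ℝ
  | 0 => 1
  | n + 1 => a n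

theorem summable_abs_consOne {a : ℕ → ℝ} (ha : Summable fun n => |a n|) :
    Summable fun n => |consOne a n| := by
  rw [← summable_nat_add_iff 1]
  exact ha

theorem isInversePair_zeroExt {c b : ℕ → ℝ} (hc : Summable fun n => |c n|)
    (hb : Summable fun n => |b n|)
    (h : ∀ n, ∑ i ∈ Finset.range (n + 1), c i * b (n - i) = if n = 0 then 1 else 0) :
    IsInversePair (zeroExt c) (zeroExt b) where
  summable_left := summable_abs_zeroExt hc
  summable_right := summable_abs_zeroExt hb
  left_neg _ := zeroExt_neg c
  right_neg _ := zeroExt_neg b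
  conv n := by
    rw [← hasSum_int_iff_nat fun i hi => by rw [zeroExt_neg c hi, zero_mul]]
    rcases lt_or_ge n 0 with hn | hn
    · rw [if_neg hn.ne]
      convert hasSum_zero using 2 with i
      rw [zeroExt_neg b (by omega), mul_zero]
    · lift n to ℕ using hn
      have h1 : ∑ i ∈ Finset.range (n + 1), zeroExt c i * zeroExt b (n - i) =
          if (n : ℤ) = 0 then 1 else 0 := by
        simp only [Nat.cast_eq_zero]
        rw [← h n]
        refine Finset.sum_congr rfl fun i hi => ?_
        rw [← Nat.cast_sub (by simpa [Nat.lt_succ_iff] using hi), zeroExt_natCast, zeroExt_natCast]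
      rw [← h1]
      refine hasSum_sum_of_ne_finset_zero fun i hi => ?_
      rw [Finset.mem_range] at hi
      rw [zeroExt_neg b (by omega), mul_zero]

end ZeroExtension

/-! ### The moving-average representation and covariances of linear processes -/

namespace ARInf

variable {Ω : Type*} [MeasurableSpace Ω] {μ : Measure Ω}

theorem charSeries_eq_tsum {a : ℕ → ℝ} (ha : Summable fun n => |a n|) {z : ℂ} (hz : ‖z‖ ≤ 1) :
    charSeries a z = ∑' n, (consOne a n : ℂ) * z ^ n := by
  have hs : Summable fun n => (consOne a n : ℂ) * z ^ n := by
    refine Summable.of_norm_bounded (summable_abs_consOne ha) fun n => ?_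
    rw [norm_mul, norm_pow, Complex.norm_real, Real.norm_eq_abs]
    exact mul_le_of_le_one_right (abs_nonneg _) (pow_le_one₀ (norm_nonneg _) hz)
  rw [hs.tsum_eq_zero_add]
  simp [charSeries, consOne]

theorem exists_isInversePair {a : ℕ → ℝ} (ha : Summable fun n => |a n|)
    (h0 : ∀ z : ℂ, ‖z‖ ≤ 1 → charSeries a z ≠ 0) :
    ∃ b, IsInversePair (zeroExt (consOne a)) b := by
  obtain ⟨b, hb, hconv⟩ := exists_summable_inverse (consOne a) (summable_abs_consOne ha)
    fun z hz => by rw [← charSeries_eq_tsum ha hz]; exact h0 z hz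
  exact ⟨_, isInversePair_zeroExt (summable_abs_consOne ha) hb hconv⟩

/-- By Tonelli the sum of absolute values has finite expectation. -/
theorem ae_summable_abs {ι : Type*} [Countable ι] {f : ι → Ω → ℝ} {g : ι → ℝ}
    (hf : ∀ i, Integrable (f i) μ) (hfg : ∀ i, ∫ ω, |f i ω| ∂μ ≤ g i) (hg : Summable g) :
    ∀ᵐ ω ∂μ, Summable fun i => |f i ω| := by
  have h1 : ∫⁻ ω, ∑' i, ‖f i ω‖ₑ ∂μ ≠ ⊤ := by
    rw [lintegral_tsum fun i => (hf i).1.enorm]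
    have h2 : ∀ i, ∫⁻ ω, ‖f i ω‖ₑ ∂μ ≤ ENNReal.ofReal (g i) := fun i => by
      rw [← ofReal_integral_norm_eq_lintegral_enorm (hf i)]
      exact ENNReal.ofReal_le_ofReal (hfg i)
    exact ne_top_of_le_ne_top hg.tsum_ofReal_ne_top (ENNReal.tsum_le_tsum h2)
  filter_upwards [ae_lt_top' (AEMeasurable.tsum fun i => (hf i).1.enorm) h1] with ω hω
  exact tsum_enorm_ne_top_iff_summable_norm.1 hω.ne

theorem hasSum_movingAverage_of_hasSum {α b : ℤ → ℝ} (h : IsInversePair α b) {X E : ℤ → ℝ}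
    (hE : ∀ t, HasSum (fun i => α i * X (t - i)) (E t)) {t : ℤ}
    (hs : Summable fun p : ℤ × ℤ => b p.1 * (α p.2 * X (t - p.1 - p.2))) :
    HasSum (fun s => b (t - s) * E s) (X t) := by
  have h1 : HasSum (fun j => b j * E (t - j))
      (∑' p : ℤ × ℤ, b p.1 * (α p.2 * X (t - p.1 - p.2))) :=
    hs.hasSum.prod_fiberwise fun j => (hE (t - j)).mul_left (b j)
  -- The same double series is summed by rows, giving `∑ b_j E_{t-j}`, and along the diagonals of
  -- constant total delay, where `α * b` collapses it to `X t`.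
  let φ : ℤ × ℤ ≃ ℤ × ℤ :=
    { toFun := fun p => (p.1 - p.2, p.2)
      invFun := fun p => (p.1 + p.2, p.2)
      left_inv := fun p => by simp
      right_inv := fun p => by simp }
  have h2 := (φ.hasSum_iff.2 hs.hasSum).prod_fiberwise fun n =>
    (((h.conv n).mul_right (X (t - n))).congr_fun (g := fun i =>
      ((fun p : ℤ × ℤ => b p.1 * (α p.2 * X (t - p.1 - p.2))) ∘ φ) (n, i)) (by
        intro i
        simp only [Function.comp, φ, Equiv.coe_fn_mk]
        rw [show t - (n - i) - i = t - n by ring]; ring))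
  have h3 : HasSum (fun n : ℤ => (if n = 0 then (1 : ℝ) else 0) * X (t - n)) (X t) := by
    convert hasSum_single (f := fun n : ℤ => (if n = 0 then (1 : ℝ) else 0) * X (t - n)) 0 ?_
      using 1
    · simp
    · intro n hn
      simp [hn]
  rw [h2.unique h3] at h1
  have := (Equiv.subLeft t).hasSum_iff.2 h1
  simpa [Function.comp_def] using this

theorem hasSum_zeroExt_consOne {a : ℕ → ℝ} {X : ℤ → ℝ} {t : ℤ} {r : ℝ}
    (h : HasSum (fun i : ℕ => a i * X (t - ((i : ℤ) + 1))) (r - X t)) :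
    HasSum (fun i => zeroExt (consOne a) i * X (t - i)) r := by
  rw [← hasSum_int_iff_nat fun i hi => by rw [zeroExt_neg _ hi, zero_mul],
    ← hasSum_nat_add_iff' 1]
  simp only [zeroExt_natCast, Finset.sum_range_one, consOne, Nat.cast_zero, sub_zero, one_mul]
  simpa only [Nat.cast_add, Nat.cast_one] using h

theorem IsStationary.integral_sq {x : ℤ → Ω → ℝ} (hx : IsStationary μ x) (t : ℤ) :
    ∫ ω, x t ω ^ 2 ∂μ = ∫ ω, x 0 ω ^ 2 ∂μ := by
  have := hx.cov_shift 0 0 t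
  simpa [sq] using this

theorem IsNoise.integral_sq {e : ℤ → Ω → ℝ} {σ : ℝ} (he : IsNoise μ e σ) (t : ℤ) :
    ∫ ω, e t ω ^ 2 ∂μ = σ ^ 2 := by
  rw [← he.variance_eq t, variance_of_integral_eq_zero (he.measurable t).aemeasurable
    (he.mean_zero t)]

theorem IsStationary.integral_abs_le [IsProbabilityMeasure μ] {x : ℤ → Ω → ℝ} (hx : IsStationary μ x) (t : ℤ) :
    ∫ ω, |x t ω| ∂μ ≤ 1 + ∫ ω, x 0 ω ^ 2 ∂μ := by
  have hsq := (hx.memLp t).integrable_sq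
  have hi := (hx.memLp t).integrable one_le_two
  calc ∫ ω, |x t ω| ∂μ ≤ ∫ ω, (1 + x t ω ^ 2) ∂μ := by
        refine integral_mono hi.abs ((integrable_const 1).add hsq) fun ω => ?_
        change |x t ω| ≤ 1 + x t ω ^ 2
        rw [← sq_abs]
        nlinarith [sq_nonneg (|x t ω| - 1), abs_nonneg (x t ω)]
    _ = 1 + ∫ ω, x 0 ω ^ 2 ∂μ := by
        rw [integral_add (integrable_const 1) hsq, hx.integral_sq]
        simp

/-- The `MA(∞)` representation. -/
theorem IsAR.ae_hasSum [IsProbabilityMeasure μ] {x e : ℤ → Ω → ℝ} {a : ℕ → ℝ} {σ : ℝ} (hx : IsAR μ x e a σ)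
    {b : ℤ → ℝ} (hb : IsInversePair (zeroExt (consOne a)) b) (t : ℤ) :
    ∀ᵐ ω ∂μ, HasSum (fun s => b (t - s) * e s ω) (x t ω) := by
  have hint : ∀ s, Integrable (x s) μ := fun s => (hx.stationary.memLp s).integrable one_le_two
  have hsum : ∀ᵐ ω ∂μ, Summable fun p : ℤ × ℤ => |b p.1 * (zeroExt (consOne a) p.2 * x (t - p.1 - p.2) ω)| := by
    refine ae_summable_abs (f := fun (p : ℤ × ℤ) ω => b p.1 * (zeroExt (consOne a) p.2 * x (t - p.1 - p.2) ω))
      (g := fun p => |b p.1| * |zeroExt (consOne a) p.2| * (1 + ∫ ω, x 0 ω ^ 2 ∂μ))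
      (fun p => ((hint (t - p.1 - p.2)).const_mul _).const_mul _) (fun p => ?_) ?_
    · simp only [abs_mul]
      rw [integral_const_mul, integral_const_mul, ← mul_assoc]
      exact mul_le_mul_of_nonneg_left (hx.stationary.integral_abs_le (t - p.1 - p.2))
        (mul_nonneg (abs_nonneg _) (abs_nonneg _))
    · exact (Summable.mul_of_nonneg hb.summable_right hb.summable_left (fun _ => abs_nonneg _)
        (fun _ => abs_nonneg _)).mul_right (1 + ∫ ω, x 0 ω ^ 2 ∂μ)
  filter_upwards [hsum, ae_all_iff.2 hx.eqn] with ω h1 h2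
  have h3 : ∀ t, HasSum (fun i => zeroExt (consOne a) i * x (t - i) ω) (e t ω) := fun t =>
    hasSum_zeroExt_consOne (X := fun t => x t ω) (h2 t)
  exact hasSum_movingAverage_of_hasSum hb (X := fun t => x t ω) (E := fun t => e t ω) h3
    (summable_abs_iff.1 h1)

theorem IsNoise.integral_mul {e : ℤ → Ω → ℝ} {σ : ℝ} (he : IsNoise μ e σ) (s u : ℤ) :
    ∫ ω, e s ω * e u ω ∂μ = if s = u then σ ^ 2 else 0 := by
  split_ifs with h
  · subst h
    rw [← he.integral_sq s]
    simp only [sq]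
  · rw [(he.indep.indepFun h).integral_fun_mul_eq_mul_integral
      (he.measurable s).aestronglyMeasurable (he.measurable u).aestronglyMeasurable,
      he.mean_zero, zero_mul]

theorem IsNoise.integral_abs_mul_le {e : ℤ → Ω → ℝ} {σ : ℝ} (he : IsNoise μ e σ) (s u : ℤ) :
    ∫ ω, |e s ω * e u ω| ∂μ ≤ 2 * σ ^ 2 := by
  have h1 := (he.memLp s).integrable_sq
  have h2 := (he.memLp u).integrable_sq
  calc ∫ ω, |e s ω * e u ω| ∂μ ≤ ∫ ω, (e s ω ^ 2 + e u ω ^ 2) ∂μ := by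
        refine integral_mono ((he.memLp s).integrable_mul (he.memLp u)).abs (h1.add h2) fun ω => ?_
        change |e s ω * e u ω| ≤ e s ω ^ 2 + e u ω ^ 2
        rw [abs_le]
        constructor <;> nlinarith [sq_nonneg (e s ω + e u ω), sq_nonneg (e s ω - e u ω)]
    _ = 2 * σ ^ 2 := by rw [integral_add h1 h2, he.integral_sq, he.integral_sq]; ring

/-- Covariance of two linear processes. -/
theorem IsNoise.integral_mul_of_hasSum {e : ℤ → Ω → ℝ} {σ : ℝ} (he : IsNoise μ e σ)
    {f g : ℤ → ℝ} (hf : Summable fun n => |f n|) (hg : Summable fun n => |g n|) {y z : Ω → ℝ}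
    (hy : ∀ᵐ ω ∂μ, HasSum (fun s => f s * e s ω) (y ω))
    (hz : ∀ᵐ ω ∂μ, HasSum (fun s => g s * e s ω) (z ω)) :
    ∫ ω, y ω * z ω ∂μ = σ ^ 2 * ∑' n, f n * g n := by
  have hfg : Summable fun p : ℤ × ℤ => |f p.1| * |g p.2| :=
    hf.mul_of_nonneg hg (fun _ => abs_nonneg _) (fun _ => abs_nonneg _)
  have hF : HasSum
      (fun p : ℤ × ℤ => ∫ ω, (f p.1 * g p.2) * (e p.1 ω * e p.2 ω) ∂μ)
      (∫ ω, ∑' p : ℤ × ℤ, (f p.1 * g p.2) * (e p.1 ω * e p.2 ω) ∂μ) := by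
    refine hasSum_integral_of_summable_integral_norm
      (F := fun (p : ℤ × ℤ) ω => (f p.1 * g p.2) * (e p.1 ω * e p.2 ω))
      (fun p => ((he.memLp p.1).integrable_mul (he.memLp p.2)).const_mul _) ?_
    refine Summable.of_nonneg_of_le (fun p => integral_nonneg fun _ => norm_nonneg _)
      (fun p => ?_) (hfg.mul_right (2 * σ ^ 2))
    simp only [Real.norm_eq_abs, abs_mul (f p.1 * g p.2)]
    rw [integral_const_mul, abs_mul (f p.1)]
    exact mul_le_mul_of_nonneg_left (he.integral_abs_mul_le _ _) (by positivity)
  have h1 : ∫ ω, ∑' p : ℤ × ℤ, (f p.1 * g p.2) * (e p.1 ω * e p.2 ω) ∂μ =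
      ∫ ω, y ω * z ω ∂μ := by
    refine integral_congr_ae ?_
    filter_upwards [hy, hz] with ω h1 h2
    rw [← h1.tsum_eq, ← h2.tsum_eq,
      tsum_mul_tsum_of_summable_norm h1.summable.norm h2.summable.norm]
    congr 1
    ext p
    ring
  rw [h1] at hF
  have h2 := hF.prod_fiberwise (g := fun s => f s * g s * σ ^ 2) fun s => by
    simp only [integral_const_mul, he.integral_mul]
    convert hasSum_single (f := fun u => f s * g u * if s = u then σ ^ 2 else 0) s ?_ using 1
    · simp
    · intro u hu
      rw [if_neg (Ne.symm hu), mul_zero]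
  rw [← h2.tsum_eq, tsum_mul_right, mul_comm]

end ARInf

/-! ### Best linear predictors, normal equations and the norm of coefficient differences -/

namespace ARInf

variable {Ω : Type*} [MeasurableSpace Ω] {μ : Measure Ω} {x e : ℤ → Ω → ℝ} {a : ℕ → ℝ} {σ : ℝ}

section Minimizer

variable {k : ℕ}

theorem IsStationary.memLp_resid (hx : IsStationary μ x) (c : Fin k → ℝ) (t : ℤ) :
    MemLp (resid x c t) 2 μ :=
  (hx.memLp (t + 1)).add (memLp_finsetSum _ fun i _ => by
    simp only [mul_comm _ (c i)]
    exact (hx.memLp _).const_mul (c i))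

theorem IsStationary.measurable_resid (hx : IsStationary μ x) (c : Fin k → ℝ) (t : ℤ) :
    Measurable (resid x c t) :=
  (hx.measurable (t + 1)).add (Finset.measurable_fun_sum _ fun i _ =>
    (hx.measurable _).mul_const (c i))

/-- Projection onto a finite-dimensional subspace of `L²`. Existence is what makes the choice in
`coef` meaningful; any minimizer will do, as only the normal equations and minimality are used. -/
theorem IsStationary.exists_minimizer (hx : IsStationary μ x) (k : ℕ) :
    ∃ c : Fin k → ℝ, ∀ c' : Fin k → ℝ, mse μ x k c ≤ mse μ x k c' := by
  let X : ℤ → Lp ℝ 2 μ := fun t => (hx.memLp t).toLp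
  let L : (Fin k → ℝ) →ₗ[ℝ] Lp ℝ 2 μ := Fintype.linearCombination ℝ fun i : Fin k => X (k - (i : ℕ))
  have hcoe : ∀ c, (X (k + 1) + L c : Lp ℝ 2 μ) =ᵐ[μ] resid x c k := fun c => by
    have h1 := Lp.coeFn_fun_finsetSum (p := 2) (μ := μ) Finset.univ
      fun i : Fin k => c i • X (k - (i : ℕ))
    have h2 : ∀ i : Fin k, ∀ᵐ ω ∂μ, (c i • X (k - (i : ℕ)) : Lp ℝ 2 μ) ω =
        c i * x (k - (i : ℕ)) ω := fun i => by
      filter_upwards [Lp.coeFn_smul (c i) (X (k - (i : ℕ))), (hx.memLp (k - (i : ℕ))).coeFn_toLp]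
        with ω h3 h4
      rw [h3, Pi.smul_apply, smul_eq_mul, h4]
    have hL : L c = ∑ i : Fin k, c i • X (k - (i : ℕ)) := Fintype.linearCombination_apply ℝ _ c
    filter_upwards [Lp.coeFn_add (X (k + 1)) (L c), h1, ae_all_iff.2 h2,
      (hx.memLp (k + 1)).coeFn_toLp] with ω h3 h4 h5 h6
    rw [h3, Pi.add_apply, h6, hL, h4, resid]
    congr 1
    exact Finset.sum_congr rfl fun i _ => by rw [h5, mul_comm]
  have hmse : ∀ c, mse μ x k c = ‖X (k + 1) + L c‖ ^ 2 := fun c => by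
    rw [← real_inner_self_eq_norm_sq, L2.inner_def, mse]
    refine integral_congr_ae ?_
    filter_upwards [hcoe c] with ω h
    rw [h, real_inner_self_eq_norm_sq, Real.norm_eq_abs, sq_abs]
  obtain ⟨v, ⟨c, rfl⟩, hv⟩ := (LinearMap.range L).exists_norm_eq_iInf_of_complete_subspace
    (LinearMap.range L).complete_of_finiteDimensional (-X (k + 1))
  refine ⟨c, fun c' => ?_⟩
  rw [hmse, hmse]
  have h1 : ‖-X (k + 1) - L c‖ ≤ ‖-X (k + 1) - L c'‖ := by
    rw [hv]
    exact ciInf_le ⟨0, by rintro _ ⟨w, rfl⟩; exact norm_nonneg _⟩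
      (⟨L c', c', rfl⟩ : (LinearMap.range L : Set (Lp ℝ 2 μ)))
  rw [← neg_add', ← neg_add', norm_neg, norm_neg] at h1
  gcongr

theorem IsStationary.mse_coef_le (hx : IsStationary μ x) (c : Fin k → ℝ) :
    mse μ x k (coef μ x k) ≤ mse μ x k c :=
  Classical.epsilon_spec (hx.exists_minimizer k) c

/-- The normal equations. -/
theorem IsStationary.integral_resid_mul (hx : IsStationary μ x) (i : Fin k) :
    ∫ ω, resid x (coef μ x k) k ω * x (k - (i : ℕ)) ω ∂μ = 0 := by
  set c := coef μ x k with hc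
  set I := ∫ ω, resid x c k ω * x (k - (i : ℕ)) ω ∂μ with hI
  set G := ∫ ω, x (k - (i : ℕ)) ω ^ 2 ∂μ with hG
  have hr := hx.memLp_resid c k
  have hxi := hx.memLp (k - (i : ℕ))
  have key : ∀ τ : ℝ, 0 ≤ 2 * τ * I + τ ^ 2 * G := fun τ => by
    have h1 : ∀ ω, resid x (Function.update c i (c i + τ)) k ω =
        resid x c k ω + τ * x (k - (i : ℕ)) ω := fun ω => by
      rw [resid, resid, add_assoc]
      congr 1
      rw [← Finset.add_sum_erase _ _ (Finset.mem_univ i),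
        ← Finset.add_sum_erase _ (fun j : Fin k => x (k - (j : ℕ)) ω * c j) (Finset.mem_univ i),
        Function.update_self, Finset.sum_congr rfl fun j hj => by
          rw [Function.update_of_ne (Finset.ne_of_mem_erase hj)]]
      ring
    have h2 := hx.mse_coef_le (Function.update c i (c i + τ))
    rw [← hc, mse, mse] at h2
    have h3 : ∫ ω, resid x (Function.update c i (c i + τ)) k ω ^ 2 ∂μ =
        ∫ ω, resid x c k ω ^ 2 ∂μ + (2 * τ * I + τ ^ 2 * G) := by
      have i1 := hr.integrable_sq
      have i2 : Integrable (fun ω => 2 * τ * (resid x c k ω * x (k - (i : ℕ)) ω)) μ :=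
        (hr.integrable_mul hxi).const_mul (2 * τ)
      have i3 := hxi.integrable_sq.const_mul (τ ^ 2)
      have i4 : Integrable (fun ω => 2 * τ * (resid x c k ω * x (k - (i : ℕ)) ω) +
          τ ^ 2 * x (k - (i : ℕ)) ω ^ 2) μ := i2.add i3
      rw [hI, hG, ← integral_const_mul, ← integral_const_mul, ← integral_add i2 i3,
        ← integral_add i1 i4]
      congr 1
      ext ω
      rw [h1 ω]
      ring
    linarith
  have hG0 : 0 ≤ G := integral_nonneg fun ω => sq_nonneg _
  -- The optimal `τ` would be `-I / G`; the shift by `1` also covers `G = 0`.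
  have h := key (-I / (G + 1))
  have h4 : 2 * (-I / (G + 1)) * I + (-I / (G + 1)) ^ 2 * G =
      -((I / (G + 1)) ^ 2 * (G + 2)) := by
    field_simp
    ring
  rw [h4] at h
  have h5 : (I / (G + 1)) ^ 2 * (G + 2) = 0 :=
    le_antisymm (by linarith) (by positivity)
  have h6 : I / (G + 1) = 0 := by
    rcases mul_eq_zero.1 h5 with h7 | h7
    · exact pow_eq_zero_iff two_ne_zero |>.1 h7
    · linarith
  rcases div_eq_zero_iff.1 h6 with h7 | h7
  · exact h7
  · linarith

end Minimizer

/-- The coefficients `1, a₁(k), …, a_k(k)` of the prediction error, extended by zero to `ℤ`. -/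
noncomputable def errCoef (μ : Measure Ω) (x : ℤ → Ω → ℝ) (k : ℕ) : ℤ → ℝ :=
  zeroExt (consOne (coefSeq μ x k))

/-- The `MA(∞)` coefficients of the prediction error. -/
noncomputable def errMA (μ : Measure Ω) (x : ℤ → Ω → ℝ) (b : ℤ → ℝ) (k : ℕ) : ℤ → ℝ :=
  convWindow b k (errCoef μ x k)

theorem sum_Icc_int_eq (f : ℤ → ℝ) (k : ℕ) :
    ∑ l ∈ Finset.Icc (0 : ℤ) k, f l = ∑ l ∈ Finset.range (k + 1), f l := by
  refine (Finset.sum_nbij (fun l : ℕ => (l : ℤ)) (fun l hl => ?_) (fun _ _ _ _ h => by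
    simpa using h) (fun l hl => ?_) fun _ _ => rfl).symm
  · rw [Finset.mem_range] at hl
    rw [Finset.mem_Icc]; omega
  · rw [Finset.mem_coe, Finset.mem_Icc] at hl
    exact ⟨l.toNat, by rw [Finset.mem_coe, Finset.mem_range]; omega, by simp; omega⟩

theorem errMA_apply (b : ℤ → ℝ) (k : ℕ) (n : ℤ) :
    errMA μ x b k n = b n + ∑ i : Fin k, b (n - 1 - (i : ℕ)) * coef μ x k i := by
  rw [errMA, convWindow, sum_Icc_int_eq, Finset.sum_range_succ', add_comm]
  congr 1
  · rw [errCoef, zeroExt_natCast, consOne, one_mul, Nat.cast_zero, sub_zero]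
  · rw [← Fin.sum_univ_eq_sum_range
      (fun i => errCoef μ x k ((i + 1 : ℕ) : ℤ) * b (n - ((i + 1 : ℕ) : ℤ)))]
    refine Finset.sum_congr rfl fun i _ => ?_
    rw [errCoef, zeroExt_natCast, consOne, coefSeq, dif_pos i.2, mul_comm]
    congr 2
    push_cast
    ring

/-- A finite linear combination of the representations of `x`. The time index is `t + 1` because the
residual at `t` predicts `x (t + 1)`. -/
theorem ae_hasSum_resid {b : ℤ → ℝ}
    (hMA : ∀ t, ∀ᵐ ω ∂μ, HasSum (fun s => b (t - s) * e s ω) (x t ω)) (k : ℕ) (t : ℤ) :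
    ∀ᵐ ω ∂μ, HasSum (fun s => errMA μ x b k (t + 1 - s) * e s ω)
      (resid x (coef μ x k) t ω) := by
  filter_upwards [ae_all_iff.2 hMA] with ω h
  have h1 := (h (t + 1)).add (hasSum_sum (s := Finset.univ) fun (i : Fin k) _ =>
    (h (t - (i : ℕ))).mul_right (coef μ x k i))
  refine h1.congr_fun fun s => ?_
  rw [errMA_apply, add_mul, Finset.sum_mul]
  congr 1
  refine Finset.sum_congr rfl fun i _ => ?_
  rw [show t + 1 - s - 1 - (i : ℕ) = t - (i : ℕ) - s by ring]
  ring

theorem resid_eq_sum_range {k K : ℕ} (hk : k ≤ K) (t : ℤ) (ω : Ω) :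
    resid x (coef μ x k) t ω =
      x (t + 1) ω + ∑ i ∈ Finset.range K, coefSeq μ x k i * x (t - (i : ℕ)) ω := by
  rw [resid]
  congr 1
  rw [← Finset.sum_subset (Finset.range_subset_range.2 hk) fun i _ hi => by
    rw [coefSeq, dif_neg (by simpa using hi), zero_mul], ← Fin.sum_univ_eq_sum_range
    (fun i => coefSeq μ x k i * x (t - (i : ℕ)) ω)]
  refine Finset.sum_congr rfl fun i _ => ?_
  rw [coefSeq, dif_pos i.2, mul_comm]

theorem IsStationary.integral_mul_eq_autocov (hx : IsStationary μ x) (s t : ℤ) :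
    ∫ ω, x s ω * x t ω ∂μ = autocov μ x (s - t) := by
  have := hx.cov_shift (s - t) 0 t
  rw [sub_add_cancel, zero_add] at this
  exact this

theorem IsStationary.integrable_mul (hx : IsStationary μ x) (s t : ℤ) :
    Integrable (fun ω => x s ω * x t ω) μ :=
  (hx.memLp s).integrable_mul (hx.memLp t)

/-- `‖𝐚(j) - 𝐚(k)‖_R` is the `L²` distance of the prediction errors. -/
theorem IsStationary.normR_sq (hx : IsStationary μ x) (k j : ℕ) (t : ℤ) :
    normR μ x (fun i => coefSeq μ x j i - coefSeq μ x k i) ^ 2 =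
      ∫ ω, (resid x (coef μ x k) t ω - resid x (coef μ x j) t ω) ^ 2 ∂μ := by
  set d : ℕ → ℝ := fun i => coefSeq μ x j i - coefSeq μ x k i with hd
  set K := max k j with hK
  have hd0 : ∀ i, i ∉ Finset.range K → d i = 0 := fun i hi => by
    rw [Finset.mem_range] at hi
    simp only [hd, coefSeq]
    rw [dif_neg (by omega), dif_neg (by omega), sub_zero]
  have h1 : ∑' p : ℕ × ℕ, d p.1 * d p.2 * autocov μ x ((p.1 : ℤ) - (p.2 : ℤ)) =
      ∑ i ∈ Finset.range K, ∑ l ∈ Finset.range K, d i * d l * autocov μ x ((i : ℤ) - (l : ℤ)) := by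
    rw [← Finset.sum_product', tsum_eq_sum]
    intro p hp
    rw [Finset.mem_product, not_and_or] at hp
    rcases hp with hp | hp
    · rw [hd0 _ hp]; ring
    · rw [hd0 _ hp]; ring
  have h2 : ∫ ω, (resid x (coef μ x k) t ω - resid x (coef μ x j) t ω) ^ 2 ∂μ =
      ∑ i ∈ Finset.range K, ∑ l ∈ Finset.range K, d i * d l * autocov μ x ((i : ℤ) - (l : ℤ)) := by
    have h3 : ∀ ω, (resid x (coef μ x k) t ω - resid x (coef μ x j) t ω) ^ 2 =
        ∑ i ∈ Finset.range K, ∑ l ∈ Finset.range K,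
          d i * d l * (x (t - (l : ℕ)) ω * x (t - (i : ℕ)) ω) := fun ω => by
      rw [resid_eq_sum_range (le_max_left k j), resid_eq_sum_range (le_max_right k j),
        add_sub_add_left_eq_sub, ← Finset.sum_sub_distrib, sq, Finset.sum_mul_sum]
      refine Finset.sum_congr rfl fun i _ => Finset.sum_congr rfl fun l _ => ?_
      simp only [hd]
      ring
    simp only [h3]
    rw [integral_finsetSum _ fun i _ => integrable_finsetSum _ fun l _ =>
      (hx.integrable_mul _ _).const_mul _]
    refine Finset.sum_congr rfl fun i _ => ?_
    rw [integral_finsetSum _ fun l _ => (hx.integrable_mul _ _).const_mul _]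
    refine Finset.sum_congr rfl fun l _ => ?_
    rw [integral_const_mul, hx.integral_mul_eq_autocov]
    congr 2
    ring
  rw [normR, Real.sq_sqrt, h1, h2]
  rw [h1, ← h2]
  exact integral_nonneg fun ω => sq_nonneg _

/-! ### Uniform summability of the predictor coefficients -/

section UniformBound

variable {b : ℤ → ℝ}

theorem tsum_shift_mul (f g : ℤ → ℝ) (t : ℤ) : ∑' s, f (t - s) * g (t - s) = ∑' n, f n * g n :=
  (Equiv.subLeft t).tsum_eq fun n => f n * g n

theorem summable_abs_subLeft {f : ℤ → ℝ} (hf : Summable fun n => |f n|) (t : ℤ) :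
    Summable fun s => |f (t - s)| :=
  (Equiv.subLeft t).summable_iff.2 hf

theorem summable_abs_errMA (hb : Summable fun n => |b n|) (k : ℕ) :
    Summable fun n => |errMA μ x b k n| := summable_convWindow hb k _

theorem IsNoise.integral_mul_of_hasSum_shift (he : IsNoise μ e σ) {f g : ℤ → ℝ}
    (hf : Summable fun n => |f n|) (hg : Summable fun n => |g n|) {y z : Ω → ℝ} {t : ℤ}
    (hy : ∀ᵐ ω ∂μ, HasSum (fun s => f (t - s) * e s ω) (y ω))
    (hz : ∀ᵐ ω ∂μ, HasSum (fun s => g (t - s) * e s ω) (z ω)) :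
    ∫ ω, y ω * z ω ∂μ = σ ^ 2 * ∑' n, f n * g n := by
  rw [he.integral_mul_of_hasSum (summable_abs_subLeft hf t) (summable_abs_subLeft hg t) hy hz,
    tsum_shift_mul]

/-- The prediction coefficients are bounded in `ℓ¹`, uniformly in the order. -/
theorem IsAR.exists_sum_abs_errCoef_le [IsProbabilityMeasure μ] (hx : IsAR μ x e a σ)
    (hσ : σ ≠ 0) (hb : IsInversePair (zeroExt (consOne a)) b) :
    ∃ C : ℝ, ∀ k : ℕ, ∑ l ∈ Finset.Icc (0 : ℤ) k, |errCoef μ x k l| ≤ C := by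
  have hMA := hx.ae_hasSum hb
  have hσ2 : 0 < σ ^ 2 := by positivity
  set γ := ∫ ω, x 0 ω ^ 2 ∂μ with hγ
  obtain ⟨m, hm⟩ := hb.exists_tail_le
  -- The zero predictor competes, so the error variance `σ² ‖β_k‖₂²` is at most `γ`, which bounds
  -- every coefficient by `B`. Neither `B` nor `m` depends on `k`.
  refine ⟨_, fun k => hb.sum_abs_le_of_correlation_eq_zero (B := √(γ / σ ^ 2)) (m := m)
    (fun n => ?_) (fun j hj1 hjk => ?_) hm⟩
  · change |errMA μ x b k n| ≤ _
    have hs := summable_abs_errMA (μ := μ) (x := x) hb.summable_right k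
    have h1 : σ ^ 2 * ∑' n, errMA μ x b k n * errMA μ x b k n ≤ γ := by
      rw [← hx.noise.integral_mul_of_hasSum_shift hs hs (ae_hasSum_resid hMA k k)
        (ae_hasSum_resid hMA k k)]
      have h2 := hx.stationary.mse_coef_le (k := k) 0
      have h3 : mse μ x k 0 = γ := by
        simp only [mse, resid, Pi.zero_apply, mul_zero, Finset.sum_const_zero, add_zero]
        exact hx.stationary.integral_sq _
      rw [h3] at h2
      simpa only [mse, sq] using h2
    have h4 : errMA μ x b k n ^ 2 ≤ ∑' n, errMA μ x b k n * errMA μ x b k n := by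
      have := (summable_sq_of_summable_abs hs).le_tsum n fun _ _ => sq_nonneg _
      simpa only [sq] using this
    refine Real.abs_le_sqrt ?_
    rw [le_div_iff₀ hσ2]
    nlinarith
  -- Relative to time `k + 1`, the regressor `x (k - i)` has lag `i + 1 = j`. Its normal equation,
  -- divided by `σ² ≠ 0`, is the vanishing of the correlation at `j`.
  · have hs := summable_abs_errMA (μ := μ) (x := x) hb.summable_right k
    lift j to ℕ using by omega
    obtain ⟨i, rfl⟩ : ∃ i, j = i + 1 := ⟨j - 1, by omega⟩
    have h1 := hx.stationary.integral_resid_mul (k := k) ⟨i, by omega⟩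
    have hz := hMA (k - (i : ℕ))
    have h2 := hx.noise.integral_mul_of_hasSum_shift (t := k + 1)
      (g := fun n => b (n - ((i + 1 : ℕ) : ℤ))) hs
      (summable_abs_shift hb.summable_right _) (ae_hasSum_resid hMA k k)
      (hz.mono fun ω hω => hω.congr_fun fun s => by
        rw [show (k : ℤ) + 1 - s - ((i + 1 : ℕ) : ℤ) = k - (i : ℕ) - s by push_cast; ring])
    rw [h1] at h2
    rcases mul_eq_zero.1 h2.symm with h3 | h3
    · exact absurd h3 hσ2.ne'
    · exact h3

theorem IsAR.exists_tsum_abs_errMA_le [IsProbabilityMeasure μ] (hx : IsAR μ x e a σ)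
    (hσ : σ ≠ 0) (hb : IsInversePair (zeroExt (consOne a)) b) :
    ∃ C : ℝ, 0 ≤ C ∧ ∀ k : ℕ, ∑' n, |errMA μ x b k n| ≤ C := by
  obtain ⟨C, hC⟩ := hx.exists_sum_abs_errCoef_le hσ hb
  have hb0 : 0 ≤ ∑' n, |b n| := tsum_nonneg fun _ => abs_nonneg _
  have hC0 : 0 ≤ C := (Finset.sum_nonneg fun _ _ => abs_nonneg _).trans (hC 0)
  exact ⟨C * ∑' n, |b n|, mul_nonneg hC0 hb0, fun k =>
    (tsum_abs_convWindow_le hb.summable_right k _).trans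
      (mul_le_mul_of_nonneg_right (hC k) hb0)⟩

end UniformBound

end ARInf

/-! ### Moments of centred sample variances and the final estimates -/

namespace ARInf

theorem quadConst_nonneg {q m m₂ : ℝ} (hq : 2 ≤ q) (hm₂ : 0 ≤ m₂) : 0 ≤ quadConst q m m₂ := by
  have hC := one_le_martConst hq
  have := mul_nonneg (by linarith : 0 ≤ martConst q) hm₂
  unfold quadConst
  positivity

variable {Ω : Type*} [MeasurableSpace Ω] {μ : Measure Ω} [IsProbabilityMeasure μ]
  {x e : ℤ → Ω → ℝ} {a : ℕ → ℝ} {σ q : ℝ}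

/-- The moment of order `2q` is what puts the diagonal variables `e² - v` in `L^q`. The exponent
`2/q` in the witnesses undoes the power `q/2` in `MomentBound`. -/
theorem exists_momentBound_noise (he : ∀ t, Measurable (e t)) (hq : 2 ≤ q) (v : ℝ)
    (hmom : (⨆ t : ℤ, ∫⁻ ω, ENNReal.ofReal (|e t ω| ^ (2 * q)) ∂μ) < ∞) :
    ∃ m m₂ : ℝ, (∀ t, MomentBound μ q (e t) m) ∧
      ∀ t, MomentBound μ q (fun ω => e t ω ^ 2 - v) m₂ := by
  set S := ⨆ t : ℤ, ∫⁻ ω, ENNReal.ofReal (|e t ω| ^ (2 * q)) ∂μ with hS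
  set R := S.toReal with hR
  have hR0 : 0 ≤ R := ENNReal.toReal_nonneg
  have hle : ∀ t, ∫⁻ ω, ENNReal.ofReal (|e t ω| ^ (2 * q)) ∂μ ≤ S := fun t =>
    le_iSup (fun t : ℤ => ∫⁻ ω, ENNReal.ofReal (|e t ω| ^ (2 * q)) ∂μ) t
  have hint : ∀ t, Integrable (fun ω => |e t ω| ^ (2 * q)) μ := fun t => by
    refine ⟨(measurable_abs_rpow (he t) _).aestronglyMeasurable, ?_⟩
    rw [hasFiniteIntegral_iff_ofReal (Filter.Eventually.of_forall fun ω => by positivity)]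
    exact (hle t).trans_lt hmom
  have hval : ∀ t, ∫ ω, |e t ω| ^ (2 * q) ∂μ ≤ R := fun t => by
    rw [integral_eq_lintegral_of_nonneg_ae (Filter.Eventually.of_forall fun ω => by positivity)
      (hint t).1]
    exact ENNReal.toReal_mono hmom.ne (hle t)
  have hroot : ∀ W : ℝ, 0 ≤ W → (W ^ (2 / q)) ^ (q / 2) = W := fun W hW => by
    rw [← Real.rpow_mul hW, show 2 / q * (q / 2) = 1 by field_simp, Real.rpow_one]
  have hpt : ∀ r : ℝ, |r| ^ q ≤ 1 + |r| ^ (2 * q) := fun r => by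
    have h1 : |r| ^ (2 * q) = (|r| ^ q) ^ 2 := by
      rw [mul_comm, Real.rpow_mul (abs_nonneg r), Real.rpow_two]
    rw [h1]
    nlinarith [sq_nonneg (|r| ^ q - 1 / 2)]
  have hsq : ∀ r : ℝ, |r ^ 2| ^ q = |r| ^ (2 * q) := fun r => by
    rw [abs_pow, ← Real.rpow_two, ← Real.rpow_mul (abs_nonneg r)]
  have h1 : ∀ t, MomentBound μ q (e t) ((1 + R) ^ (2 / q)) := fun t => by
    have hi : Integrable (fun ω => 1 + |e t ω| ^ (2 * q)) μ := (integrable_const 1).add (hint t)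
    have hi' : Integrable (fun ω => |e t ω| ^ q) μ := by
      refine Integrable.mono' hi (measurable_abs_rpow (he t) _).aestronglyMeasurable
        (Filter.Eventually.of_forall fun ω => ?_)
      rw [Real.norm_of_nonneg (by positivity)]
      exact hpt _
    refine ⟨he t, by positivity, hi', ?_⟩
    rw [hroot _ (by positivity)]
    refine (integral_mono hi' hi fun ω => hpt _).trans ?_
    rw [integral_add (integrable_const 1) (hint t)]
    simpa using hval t
  have h2 : ∀ t, MomentBound μ q (fun ω => e t ω ^ 2) (R ^ (2 / q)) := fun t => by
    refine ⟨(he t).pow_const 2, by positivity, ?_, ?_⟩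
    · simpa only [hsq] using hint t
    · rw [hroot _ hR0]
      simpa only [hsq] using hval t
  exact ⟨_, _, h1, fun t => (h2 t).add (MomentBound.const (-v)) hq⟩

/-- Moments of a centred sample covariance of two moving averages. -/
theorem IsNoise.momentBound_average (he : IsNoise μ e σ) (hq : 2 ≤ q) {m m₂ : ℝ}
    (hm : ∀ t, MomentBound μ q (e t) m)
    (hm₂ : ∀ t, MomentBound μ q (fun ω => e t ω ^ 2 - σ ^ 2) m₂) {β c : ℤ → ℝ}
    (hβ : Summable fun n => |β n|) (hc : Summable fun n => |c n|)
    {y z : ℤ → Ω → ℝ} (hym : ∀ t, Measurable (y t)) (hzm : ∀ t, Measurable (z t))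
    (hy : ∀ t, ∀ᵐ ω ∂μ, HasSum (fun s => β (t + 1 - s) * e s ω) (y t ω))
    (hz : ∀ t, ∀ᵐ ω ∂μ, HasSum (fun s => c (t + 1 - s) * e s ω) (z t ω))
    {n K : ℕ} (hK : K < n) {A : ℝ} (hA : ∑' n, |c n| ≤ A) :
    MomentBound μ q
      (fun ω => 1 / ((n : ℝ) - (K : ℝ)) *
        ∑ t ∈ Finset.Ico K n, (y (t : ℤ) ω * z (t : ℤ) ω - σ ^ 2 * ∑' n, β n * c n))
      (quadConst q m m₂ * (A ^ 2 * ∑' n, β n ^ 2) * ((n : ℝ) - (K : ℝ))⁻¹) := by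
  have hN : (0 : ℝ) < (n : ℝ) - (K : ℝ) := sub_pos.2 (by exact_mod_cast hK)
  have hvar : ∀ t, ∫ ω, (e t ω ^ 2 - σ ^ 2) ∂μ = 0 := fun t => by
    rw [integral_sub (he.memLp t).integrable_sq (integrable_const _), he.integral_sq]
    simp
  have h1 := momentBound_sum_movingAverage hq he.indep he.measurable he.mean_zero hm hm₂ hvar hβ hc
    ((Finset.Ico K n).map (Nat.castEmbedding.trans (addRightEmbedding 1))) (y := fun t => y (t - 1)) (z := fun t => z (t - 1))
    (fun t => hym _) (fun t => hzm _) (fun t => by simpa using hy (t - 1))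
    (fun t => by simpa using hz (t - 1))
  have h2 := (h1.const_mul (1 / ((n : ℝ) - (K : ℝ))))
  simp only [Finset.sum_map, Finset.card_map, Nat.card_Ico, Function.Embedding.trans_apply,
    Nat.castEmbedding_apply, addRightEmbedding_apply, add_sub_cancel_right, Nat.cast_sub hK.le] at h2
  refine h2.mono (by linarith) ?_
  have h3 : (∑' n, |c n|) ^ 2 ≤ A ^ 2 := by
    have : 0 ≤ ∑' n, |c n| := tsum_nonneg fun _ => abs_nonneg _
    gcongr
  have h4 : 0 ≤ ∑' n, β n ^ 2 := tsum_nonneg fun _ => sq_nonneg _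
  have h5 := quadConst_nonneg (m := m) hq (hm₂ 0).nonneg
  calc (1 / ((n : ℝ) - (K : ℝ))) ^ 2 * (quadConst q m m₂ *
        (((n : ℝ) - (K : ℝ)) * ((∑' n, |c n|) ^ 2 * ∑' n, β n ^ 2)))
      = quadConst q m m₂ * ((∑' n, |c n|) ^ 2 * ∑' n, β n ^ 2) * ((n : ℝ) - (K : ℝ))⁻¹ := by
        field_simp
    _ ≤ _ := by gcongr

/-- The mean of the squared residual does not depend on time, so the centring can be carried out
term by term. -/
theorem IsAR.centeredVar_eq (hx : IsAR μ x e a σ) {b : ℤ → ℝ}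
    (hb : IsInversePair (zeroExt (consOne a)) b) (n K k : ℕ) (ω : Ω) :
    centeredVar μ x n K k ω = 1 / ((n : ℝ) - (K : ℝ)) * ∑ t ∈ Finset.Ico K n,
      (resid x (coef μ x k) (t : ℤ) ω * resid x (coef μ x k) (t : ℤ) ω -
        σ ^ 2 * ∑' n, errMA μ x b k n * errMA μ x b k n) := by
  have hs := summable_abs_errMA (μ := μ) (x := x) hb.summable_right k
  have hr := ae_hasSum_resid (hx.ae_hasSum hb) k
  have h1 : ∀ t : ℤ, ∫ ω, resid x (coef μ x k) t ω ^ 2 ∂μ =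
      σ ^ 2 * ∑' n, errMA μ x b k n * errMA μ x b k n := fun t => by
    rw [← hx.noise.integral_mul_of_hasSum_shift hs hs (hr t) (hr t)]
    simp only [sq]
  rw [centeredVar]
  simp only [sampleVar]
  have hi : ∀ t : ℕ, Integrable (fun ω => resid x (coef μ x k) (t : ℤ) ω ^ 2) μ := fun t =>
    (hx.stationary.memLp_resid (coef μ x k) t).integrable_sq
  rw [integral_const_mul, integral_finsetSum _ fun t _ => hi t, ← mul_sub, ← Finset.sum_sub_distrib]
  simp only [h1]
  simp only [sq (resid x _ _ _)]

/-- Without noise, every residual vanishes almost surely. This degenerate case is separate because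
the uniform `ℓ¹` bound divides by `σ²`. -/
theorem IsAR.ae_centeredVar_eq_zero (hx : IsAR μ x e a 0) (n K k : ℕ) :
    ∀ᵐ ω ∂μ, centeredVar μ x n K k ω = 0 := by
  obtain ⟨b, hb⟩ := exists_isInversePair hx.summable hx.charSeries_ne_zero
  have he : ∀ t, ∀ᵐ ω ∂μ, e t ω = 0 := fun t => by
    have h1 := hx.noise.integral_sq t
    rw [zero_pow two_ne_zero, integral_eq_zero_iff_of_nonneg (fun ω => sq_nonneg _)
      (hx.noise.memLp t).integrable_sq] at h1
    filter_upwards [h1] with ω hω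
    simpa using hω
  have hr : ∀ t, ∀ᵐ ω ∂μ, resid x (coef μ x k) t ω = 0 := fun t => by
    filter_upwards [ae_hasSum_resid (hx.ae_hasSum hb) k t, ae_all_iff.2 he] with ω h1 h2
    simp only [h2, mul_zero] at h1
    exact h1.unique hasSum_zero
  filter_upwards [ae_all_iff.2 hr] with ω hω
  rw [hx.centeredVar_eq hb]
  simp [hω]

end ARInf

/-- Integrability belongs to the conclusion because the Bochner integral of a non-integrable
function is `0`, which would make the inequalities empty. -/
theorem lemma6 {Ω : Type*} [MeasurableSpace Ω] (μ : Measure Ω) [IsProbabilityMeasure μ]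
    (x e : ℤ → Ω → ℝ) (a : ℕ → ℝ) (σ : ℝ) (hx : ARInf.IsAR μ x e a σ)
    (q : ℝ) (hq : 2 ≤ q)
    (hmom : (⨆ t : ℤ, ∫⁻ ω, ENNReal.ofReal (|e t ω| ^ (2 * q)) ∂μ) < ∞) :
    ∃ C : ℝ, 0 < C ∧ ∀ n K : ℕ, K < n →
      (∀ k : ℕ, 1 ≤ k → k ≤ K →
        Integrable (fun ω => |ARInf.centeredVar μ x n K k ω| ^ q) μ ∧
        ∫ ω, |ARInf.centeredVar μ x n K k ω| ^ q ∂μ ≤ C * ((n : ℝ) - (K : ℝ)) ^ (-(q / 2))) ∧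
      (∀ k j : ℕ, 1 ≤ k → k ≤ K → 1 ≤ j → j ≤ K →
        Integrable
          (fun ω => |ARInf.centeredVar μ x n K k ω - ARInf.centeredVar μ x n K j ω| ^ q) μ ∧
        ∫ ω, |ARInf.centeredVar μ x n K k ω - ARInf.centeredVar μ x n K j ω| ^ q ∂μ ≤
          C * ((n : ℝ) - (K : ℝ)) ^ (-(q / 2)) *
            ARInf.normR μ x (fun i => ARInf.coefSeq μ x j i - ARInf.coefSeq μ x k i) ^ q) := by
  have hq0 : q ≠ 0 := by linarith
  by_cases hσ : σ = 0
  · subst hσ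
    refine ⟨1, one_pos, fun n K hK => ?_⟩
    have hN : (0 : ℝ) < (n : ℝ) - (K : ℝ) := sub_pos.2 (by exact_mod_cast hK)
    have hzero : ∀ k, ∀ᵐ ω ∂μ, ARInf.centeredVar μ x n K k ω = 0 :=
      hx.ae_centeredVar_eq_zero n K
    refine ⟨fun k _ _ => ?_, fun k j _ _ _ _ => ?_⟩
    · have h : (fun ω => |ARInf.centeredVar μ x n K k ω| ^ q) =ᵐ[μ] fun _ => (0 : ℝ) := by
        filter_upwards [hzero k] with ω hω
        rw [hω, abs_zero, Real.zero_rpow hq0]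
      refine ⟨(integrable_congr h).2 (integrable_zero _ _ _), ?_⟩
      rw [integral_congr_ae h, integral_zero]
      positivity
    · have h : (fun ω => |ARInf.centeredVar μ x n K k ω - ARInf.centeredVar μ x n K j ω| ^ q)
          =ᵐ[μ] fun _ => (0 : ℝ) := by
        filter_upwards [hzero k, hzero j] with ω hω hω'
        rw [hω, hω', sub_zero, abs_zero, Real.zero_rpow hq0]
      refine ⟨(integrable_congr h).2 (integrable_zero _ _ _), ?_⟩
      rw [integral_congr_ae h, integral_zero]
      have : 0 ≤ ARInf.normR μ x (fun i => ARInf.coefSeq μ x j i - ARInf.coefSeq μ x k i) :=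
        Real.sqrt_nonneg _
      positivity
  obtain ⟨b, hb⟩ := ARInf.exists_isInversePair hx.summable hx.charSeries_ne_zero
  obtain ⟨B, hB0, hB⟩ := hx.exists_tsum_abs_errMA_le hσ hb
  obtain ⟨m, m₂, hm, hm₂⟩ := ARInf.exists_momentBound_noise hx.noise.measurable hq (σ ^ 2) hmom
  have hQ := ARInf.quadConst_nonneg (m := m) hq (hm₂ 0).nonneg
  set Q := quadConst q m m₂
  set β := ARInf.errMA μ x b with hβdef
  have hβ : ∀ k, Summable fun n => |β k n| := ARInf.summable_abs_errMA hb.summable_right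
  have hr := fun k => ARInf.ae_hasSum_resid (hx.ae_hasSum hb) k
  have hrm : ∀ k t, Measurable (ARInf.resid x (ARInf.coef μ x k) t) := fun k t =>
    hx.stationary.measurable_resid _ t
  have hσ2 : 0 < σ ^ 2 := by positivity
  -- In `C₁` both `‖β_k‖₁²` and `‖β_k‖₂²` are bounded by `B²`. In `C₂` the sum `β_k + β_j` gives
  -- `(2B)²`, and `(σ²)⁻¹` converts `ρ²` into `‖β_k - β_j‖₂²`.
  set C₁ := Q * (B ^ 2 * B ^ 2) with hC₁
  set C₂ := Q * ((2 * B) ^ 2 * (σ ^ 2)⁻¹) with hC₂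
  have hC₁0 : 0 ≤ C₁ := by positivity
  have hC₂0 : 0 ≤ C₂ := by positivity
  refine ⟨1 + C₁ ^ (q / 2) + C₂ ^ (q / 2), by positivity, fun n K hK => ?_⟩
  have hN : (0 : ℝ) < (n : ℝ) - (K : ℝ) := sub_pos.2 (by exact_mod_cast hK)
  refine ⟨fun k _ _ => ?_, fun k j _ _ _ _ => ?_⟩
  · have h := hx.noise.momentBound_average hq hm hm₂ (hβ k) (hβ k) (hrm k) (hrm k) (hr k) (hr k)
      hK (hB k)
    have hsq : ∑' n, β k n ^ 2 ≤ B ^ 2 := by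
      have h1 := abs_tsum_mul_le (hβ k) (g := β k) (B := B)
        fun n => (abs_le_tsum_abs (hβ k) n).trans (hB k)
      simp only [← sq] at h1
      refine (le_abs_self _).trans (h1.trans ?_)
      rw [sq]
      exact mul_le_mul_of_nonneg_right (hB k) hB0
    have h' : MomentBound μ q (fun ω => ARInf.centeredVar μ x n K k ω)
        (C₁ * ((n : ℝ) - (K : ℝ))⁻¹) := by
      rw [funext fun ω => hx.centeredVar_eq hb n K k ω]
      refine h.mono (by linarith) ?_
      rw [hC₁]
      gcongr
    refine ⟨h'.integrable, h'.le.trans ?_⟩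
    rw [Real.mul_rpow hC₁0 (by positivity), Real.inv_rpow hN.le, ← Real.rpow_neg hN.le]
    gcongr
    have : 0 ≤ C₂ ^ (q / 2) := by positivity
    linarith
  · set ρ := ARInf.normR μ x (fun i => ARInf.coefSeq μ x j i - ARInf.coefSeq μ x k i) with hρ
    have hρ0 : 0 ≤ ρ := Real.sqrt_nonneg _
    have hsub : Summable fun n => |β k n - β j n| :=
      ((summable_abs_iff.1 (hβ k)).sub (summable_abs_iff.1 (hβ j))).abs
    have hadd : Summable fun n => |β k n + β j n| :=
      ((summable_abs_iff.1 (hβ k)).add (summable_abs_iff.1 (hβ j))).abs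
    have hrsub : ∀ t, ∀ᵐ ω ∂μ, HasSum (fun s => (β k (t + 1 - s) - β j (t + 1 - s)) * e s ω)
        (ARInf.resid x (ARInf.coef μ x k) t ω - ARInf.resid x (ARInf.coef μ x j) t ω) :=
      fun t => by
        filter_upwards [hr k t, hr j t] with ω h1 h2
        simpa only [sub_mul] using h1.sub h2
    have hradd : ∀ t, ∀ᵐ ω ∂μ, HasSum (fun s => (β k (t + 1 - s) + β j (t + 1 - s)) * e s ω)
        (ARInf.resid x (ARInf.coef μ x k) t ω + ARInf.resid x (ARInf.coef μ x j) t ω) :=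
      fun t => by
        filter_upwards [hr k t, hr j t] with ω h1 h2
        simpa only [add_mul] using h1.add h2
    have hnorm : ∑' n, |β k n + β j n| ≤ 2 * B := by
      calc ∑' n, |β k n + β j n| ≤ ∑' n, (|β k n| + |β j n|) :=
            hadd.tsum_le_tsum (fun n => abs_add_le _ _) ((hβ k).add (hβ j))
        _ = ∑' n, |β k n| + ∑' n, |β j n| := (hβ k).tsum_add (hβ j)
        _ ≤ 2 * B := by linarith [hB k, hB j]
    -- The order of the factors matters: the difference takes the `ℓ²` slot and the sum takes the
    -- `ℓ¹` slot.
    have h := hx.noise.momentBound_average hq hm hm₂ hsub hadd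
      (y := fun t ω => ARInf.resid x (ARInf.coef μ x k) t ω - ARInf.resid x (ARInf.coef μ x j) t ω)
      (z := fun t ω => ARInf.resid x (ARInf.coef μ x k) t ω + ARInf.resid x (ARInf.coef μ x j) t ω)
      (fun t => (hrm k t).sub (hrm j t)) (fun t => (hrm k t).add (hrm j t)) hrsub hradd hK hnorm
    have hsq : ∑' n, (β k n - β j n) ^ 2 = (σ ^ 2)⁻¹ * ρ ^ 2 := by
      have h1 := hx.noise.integral_mul_of_hasSum_shift hsub hsub (hrsub 0) (hrsub 0)
      rw [hρ, hx.stationary.normR_sq k j 0]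
      simp only [sq] at h1 ⊢
      rw [h1, ← sq]
      field_simp
    have hsplit : ∑' n, (β k n - β j n) * (β k n + β j n) =
        ∑' n, β k n * β k n - ∑' n, β j n * β j n := by
      have h1 := summable_sq_of_summable_abs (hβ k)
      have h2 := summable_sq_of_summable_abs (hβ j)
      simp only [sq] at h1 h2
      rw [← h1.tsum_sub h2]
      congr 1
      ext n
      ring
    have hdiff : ∀ ω, ARInf.centeredVar μ x n K k ω - ARInf.centeredVar μ x n K j ω =
        1 / ((n : ℝ) - (K : ℝ)) * ∑ t ∈ Finset.Ico K n,
          ((ARInf.resid x (ARInf.coef μ x k) t ω - ARInf.resid x (ARInf.coef μ x j) t ω) *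
            (ARInf.resid x (ARInf.coef μ x k) t ω + ARInf.resid x (ARInf.coef μ x j) t ω) -
            σ ^ 2 * ∑' n, (β k n - β j n) * (β k n + β j n)) := fun ω => by
      rw [hx.centeredVar_eq hb, hx.centeredVar_eq hb, ← mul_sub, ← Finset.sum_sub_distrib, hsplit]
      congr 1
      refine Finset.sum_congr rfl fun t _ => ?_
      ring
    rw [hsq] at h
    have h' : MomentBound μ q
        (fun ω => ARInf.centeredVar μ x n K k ω - ARInf.centeredVar μ x n K j ω)
        (C₂ * ((n : ℝ) - (K : ℝ))⁻¹ * ρ ^ 2) := by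
      rw [funext hdiff]
      refine h.mono (by linarith) (le_of_eq ?_)
      rw [hC₂]
      ring
    refine ⟨h'.integrable, h'.le.trans ?_⟩
    rw [Real.mul_rpow (by positivity) (by positivity), Real.mul_rpow hC₂0 (by positivity),
      Real.inv_rpow hN.le, ← Real.rpow_neg hN.le, ← Real.rpow_two, ← Real.rpow_mul hρ0,
      show 2 * (q / 2) = q by ring]
    gcongr
    have : 0 ≤ C₁ ^ (q / 2) := by positivity
    linarith
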